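/- A temporal graph consists of a finite loopless graph $G$, directed or undirected, and of a function $\lambda$ that assigns to each edge a set of times in $\{1,\dots,\tau\}$ at which it is available ($\tau$ is the lifetime); its number of temporal edges is $M=\sum_{e\in E(G)}|\lambda(e)|$. A vertex $u$ reaches $v$ if some walk from $u$ to $v$ traverses its edges at available times $t_1<\dots<t_q$ (strict model), respectively $t_1\le\dots\le t_q$ (non-strict model). The temporal graph is temporally connected if every vertex reaches every vertex, and temporally unilaterally connected if for any two vertices $u,v$, $u$ reaches $v$ or $v$ reaches $u$. The Strong Exponential Time Hypothesis (SETH) says that for every $\varepsilon>0$ there is a $k$ such that no algorithm decides the satisfiability of CNF formulas with $n$ variables and $m$ clauses, each of size at most $k$, in time $2^{(1-\varepsilon)n}\,(n+m)^{O(1)}$. Algorithms are deterministic random access machines with logarithmic cost. Theorem. Assume SETH. Then for every $\varepsilon>0$, in the strict and in the non-strict model, for directed and for undirected temporal graphs, no algorithm running in time $\tilde O(M^{2-\varepsilon})$ decides whether a given temporal graph with $M$ temporal edges is temporally connected, and no algorithm running in time $\tilde O(M^{2-\varepsilon})$ decides whether it is temporally unilaterally connected. Here $\tilde O$ hides factors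 polylogarithmic in $M$ and $\tau$, and the lower bounds hold even if correctness and running time are required only on non-empty temporal graphs without isolated vertices. -/

import Mathlib

namespace TemporalLowerBound

/-! ### The machine model: random access machines with logarithmic cost

A machine has registers `reg 0, reg 1, …` (a program names finitely many of them) and a memory of
cells `mem 0, mem 1, …`, all holding natural numbers. Memory is accessed by indirect addressing.
Programs are written with structured control flow (a program with jumps can be put into this form
with a constant factor overhead). Every instruction costs one plus the bit lengths of the numbers
it works with, addresses included. -/

/-- The state of a random access machine. -/
structure State where
  reg : ℕ → ℕ
  mem : ℕ → ℕ

/-- `s.setReg r x` is the state after the assignment `reg r := x`. -/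
def State.setReg (s : State) (r x : ℕ) : State :=
  { s with reg := Function.update s.reg r x }

/-- `s.setMem a x` is the state after the assignment `mem a := x`. -/
def State.setMem (s : State) (a x : ℕ) : State :=
  { s with mem := Function.update s.mem a x }

/-- The arithmetic operations: sum, truncated difference, product, and quotient rounded down
(with value `0` for division by `0`). -/
inductive ArithOp
  | add
  | sub
  | mul
  | div

/-- The value of an arithmetic operation. -/
def ArithOp.eval : ArithOp → ℕ → ℕ → ℕ
  | .add, x, y => x + y
  | .sub, x, y => x - y
  | .mul, x, y => x * y
  | .div, x, y => x / y

/-- Programs of a random access machine. -/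
inductive Prog
  /-- do nothing -/
  | skip
  /-- `reg d := c` for a number `c` written in the program -/
  | const (d c : ℕ)
  /-- `reg d := reg a ∘ reg b` for an arithmetic operation `∘` -/
  | arith (o : ArithOp) (d a b : ℕ)
  /-- `reg d := mem (reg a)` -/
  | load (d a : ℕ)
  /-- `mem (reg a) := reg b` -/
  | store (a b : ℕ)
  /-- first `p`, then `q` -/
  | seq (p q : Prog)
  /-- `p` if `reg r ≠ 0`, and `q` otherwise -/
  | cond (r : ℕ) (p q : Prog)
  /-- repeat `p` as long as `reg r ≠ 0` -/
  | loop (r : ℕ) (p : Prog)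

/-- `Exec p s s' t`: started in the state `s`, the program `p` halts in the state `s'` after a
computation of total cost `t`. The machine is deterministic: in every state exactly one rule
applies to a program. `Nat.size x` is the number of binary digits of `x`. -/
inductive Exec : Prog → State → State → ℕ → Prop
  | skip (s : State) : Exec .skip s s 1
  | const (d c : ℕ) (s : State) : Exec (.const d c) s (s.setReg d c) (1 + Nat.size c)
  | arith (o : ArithOp) (d a b : ℕ) (s : State) :
      Exec (.arith o d a b) s (s.setReg d (o.eval (s.reg a) (s.reg b)))
        (1 + Nat.size (s.reg a) + Nat.size (s.reg b))
  | load (d a : ℕ) (s : State) :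
      Exec (.load d a) s (s.setReg d (s.mem (s.reg a)))
        (1 + Nat.size (s.reg a) + Nat.size (s.mem (s.reg a)))
  | store (a b : ℕ) (s : State) :
      Exec (.store a b) s (s.setMem (s.reg a) (s.reg b))
        (1 + Nat.size (s.reg a) + Nat.size (s.reg b))
  | seq {p q : Prog} {s s₁ s₂ : State} {t₁ t₂ : ℕ} :
      Exec p s s₁ t₁ → Exec q s₁ s₂ t₂ → Exec (.seq p q) s s₂ (t₁ + t₂)
  | cond_true {r : ℕ} {p q : Prog} {s s₁ : State} {t : ℕ} :
      s.reg r ≠ 0 → Exec p s s₁ t → Exec (.cond r p q) s s₁ (1 + Nat.size (s.reg r) + t)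
  | cond_false {r : ℕ} {p q : Prog} {s s₁ : State} {t : ℕ} :
      s.reg r = 0 → Exec q s s₁ t → Exec (.cond r p q) s s₁ (1 + t)
  | loop_true {r : ℕ} {p : Prog} {s s₁ s₂ : State} {t₁ t₂ : ℕ} :
      s.reg r ≠ 0 → Exec p s s₁ t₁ → Exec (.loop r p) s₁ s₂ t₂ →
        Exec (.loop r p) s s₂ (1 + Nat.size (s.reg r) + t₁ + t₂)
  | loop_false {r : ℕ} {p : Prog} {s : State} :
      s.reg r = 0 → Exec (.loop r p) s s 1

/-- The initial state on the input `x`: the memory holds the input, followed by zeros, `reg 0`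
holds the length of the input, and all other registers hold zero. -/
def initState (x : List ℕ) : State where
  reg := fun r => if r = 0 then x.length else 0
  mem := fun a => x.getD a 0

/-- On the input `x` the program `P` halts after a computation of cost at most `T`, and its answer,
which is "yes" if `reg 0 ≠ 0` and "no" otherwise, is the truth value of `Q`. -/
def AnswersWithin (P : Prog) (x : List ℕ) (Q : Prop) (T : ℝ) : Prop :=
  ∃ (s : State) (t : ℕ), Exec P (initState x) s t ∧ (s.reg 0 ≠ 0 ↔ Q) ∧ (t : ℝ) ≤ T

/-! ### Satisfiability and the strong exponential time hypothesis -/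

/-- A formula in conjunctive normal form on `numVars` variables: a list of clauses, each of which
is a list of literals. The literal `(i, true)` is the variable `i`, and `(i, false)` is its
negation. -/
structure CNF where
  numVars : ℕ
  clauses : List (List (Fin numVars × Bool))

/-- Some assignment makes a literal true in every clause. -/
def CNF.Satisfiable (φ : CNF) : Prop :=
  ∃ f : Fin φ.numVars → Bool, ∀ c ∈ φ.clauses, ∃ ℓ ∈ c, f ℓ.1 = ℓ.2

/-- All clauses have size at most `k`. -/
def CNF.IsKCNF (φ : CNF) (k : ℕ) : Prop :=
  ∀ c ∈ φ.clauses, c.length ≤ k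

/-- The number of clauses. -/
def CNF.numClauses (φ : CNF) : ℕ := φ.clauses.length

/-- A formula as the input of a machine: the number of variables, the number of clauses, and for
each clause its size followed by its literals; the literals `i` and `¬ i` are written as `2 i + 1`
and `2 i`. -/
def CNF.encode (φ : CNF) : List ℕ :=
  φ.numVars :: φ.numClauses ::
    φ.clauses.flatMap fun c => c.length :: c.map fun ℓ => 2 * (ℓ.1 : ℕ) + ℓ.2.toNat

/-- The strong exponential time hypothesis: for every `ε > 0` there is a `k` such that no algorithm
decides the satisfiability of formulas with `n` variables and `m` clauses of size at most `k` in
time `O(2 ^ ((1 - ε) n))` up to factors polynomial in `n + m`. -/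
def SETH : Prop :=
  ∀ ε : ℝ, 0 < ε → ∃ k : ℕ, ¬ ∃ (P : Prog) (C : ℝ) (c : ℕ), ∀ φ : CNF, φ.IsKCNF k →
    AnswersWithin P φ.encode φ.Satisfiable
      (C * (2 : ℝ) ^ ((1 - ε) * (φ.numVars : ℝ)) * ((φ.numVars : ℝ) + φ.numClauses + 1) ^ c)

/-! ### Temporal graphs -/

/-- A temporal (directed) graph on the vertices `0, …, n - 1`: `lam u v` is the set of times in
`{1, …, lifetime}` at which the edge from `u` to `v` is available; there is no such edge if this
set is empty. -/
structure TemporalGraph (n : ℕ) where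
  lifetime : ℕ
  lam : Fin n → Fin n → Finset ℕ
  lam_subset : ∀ u v, lam u v ⊆ Finset.Icc 1 lifetime
  loopless : ∀ u, lam u u = ∅

/-- The two models of temporal walks: strictly increasing or non-decreasing times. -/
inductive Model
  | strict
  | nonstrict

/-- The relation between the times of earlier and later edges of a walk. -/
def Model.Rel : Model → ℕ → ℕ → Prop
  | .strict, s, t => s < t
  | .nonstrict, s, t => s ≤ t

/-- The two kinds of temporal graphs. -/
inductive Kind
  | directed
  | undirected

namespace TemporalGraph

variable {n : ℕ}

/-- `G.IsWalk u [(t₁, v₁), …, (t_q, v_q)] v`: the sequence `(u, t₁, v₁, …, t_q, v_q)` follows edges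
of `G`, each at a time when it is available, and ends in `v`. -/
def IsWalk (G : TemporalGraph n) : Fin n → List (ℕ × Fin n) → Fin n → Prop
  | u, [], v => u = v
  | u, (t, w) :: l, v => t ∈ G.lam u w ∧ G.IsWalk w l v

/-- There is a temporal walk from `u` to `v`, in the given model. -/
def Reaches (G : TemporalGraph n) (m : Model) (u v : Fin n) : Prop :=
  ∃ l : List (ℕ × Fin n), G.IsWalk u l v ∧ (l.map Prod.fst).Pairwise m.Rel

/-- Every vertex reaches every vertex. -/
def TemporallyConnected (m : Model) (G : TemporalGraph n) : Prop :=
  ∀ u v : Fin n, G.Reaches m u v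

/-- Of any two vertices, one reaches the other. -/
def TemporallyUnilaterallyConnected (m : Model) (G : TemporalGraph n) : Prop :=
  ∀ u v : Fin n, G.Reaches m u v ∨ G.Reaches m v u

/-- An undirected temporal graph is given by its two oppositely directed edges for each edge. -/
def IsOfKind (G : TemporalGraph n) : Kind → Prop
  | .directed => True
  | .undirected => ∀ u v, G.lam u v = G.lam v u

/-- The number `M` of temporal edges, which is the sum of the numbers `|λ(e)|` over all edges `e`;
in the undirected case every edge is counted once. -/
def numTemporalEdges (G : TemporalGraph n) : Kind → ℕ
  | .directed => ∑ u, ∑ v, (G.lam u v).card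
  | .undirected => ∑ u, ∑ v ∈ Finset.Ioi u, (G.lam u v).card

/-- Every vertex is incident to some temporal edge. -/
def NoIsolated (G : TemporalGraph n) : Prop :=
  ∀ u, ∃ v, (G.lam u v).Nonempty ∨ (G.lam v u).Nonempty

/-- `l` lists all triples `(u, v, t)` such that the edge from `u` to `v` is available at time `t`,
without repetition and in an arbitrary order. -/
def IsListing (G : TemporalGraph n) (l : List (Fin n × Fin n × ℕ)) : Prop :=
  l.Nodup ∧ ∀ u v t, (u, v, t) ∈ l ↔ t ∈ G.lam u v

/-- A temporal graph as the input of a machine: the number of vertices, the lifetime, the length of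
a listing of the temporal edges, and the entries of the listing. -/
def encode (G : TemporalGraph n) (l : List (Fin n × Fin n × ℕ)) : List ℕ :=
  n :: G.lifetime :: l.length :: l.flatMap fun e => [(e.1 : ℕ), (e.2.1 : ℕ), e.2.2]

end TemporalGraph

/-- Some algorithm decides the property `Q` of temporal graphs of the given kind, with `M` temporal
edges and lifetime `τ`, in time `M ^ δ` up to a constant factor and a factor polylogarithmic in
`M` and `τ`. Its correctness and its running time are required on non-empty graphs without isolated
vertices only (so the number of vertices is at most `2 M`). -/
def DecidableInSoftTime (K : Kind) (Q : ∀ n : ℕ, TemporalGraph n → Prop) (δ : ℝ) : Prop :=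
  ∃ (P : Prog) (C : ℝ) (c : ℕ), ∀ (n : ℕ) (G : TemporalGraph n) (l : List (Fin n × Fin n × ℕ)),
    0 < n → G.IsOfKind K → G.NoIsolated → G.IsListing l →
      AnswersWithin P (G.encode l) (Q n G)
        (C * (G.numTemporalEdges K : ℝ) ^ δ *
          Real.log (2 + G.numTemporalEdges K + G.lifetime) ^ c)

end TemporalLowerBound

/-!
The lower bounds follow from one reduction, which turns a formula with `n` variables and `m` clauses
into an undirected temporal graph with `O(2 ^ (n / 2) * m)` temporal edges.

The variables are split by the parity of their index, and the `Q = 2 * 2 ^ ⌈n / 2⌉` partial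
assignments to one of the two halves are the rows of a grid. Its columns are the clauses. The formula
is satisfiable if and only if there are partial assignments `p`, `p'` to different halves such that
no clause is falsified (no literal made true) by both. Two additional columns, each of them
falsified by all partial assignments to one of the halves, ensure that any two partial assignments
to the same half falsify a common column.

Each cell of the grid contains a leaf, joined to the vertex of its row at the times `6, 9`, to the
vertex of its column at the times `1, 12` and, if the row falsifies the column, `7, 8` (otherwise
`2, 3`, so that the length of the listing does not depend on the formula), and to a hub at the times
`4, 5, 10, 11`. A walk from row to row goes through the leaves at the times `6, 7, 8, 9`, and exists
only if both rows falsify the column in between (`walk_row_row`, `not_reaches_row`): the vertex of a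
row has no edges at other times than `6` and `9`. All other pairs of vertices are connected through
the hub, by strict walks. As the argument against walks covers nonstrict ones and the condition is
symmetric in the two rows, both connectivity properties, in both models, hold if and only if the
formula is unsatisfiable (`connectivity_gridGraph`, `satisfiable_iff`). A symmetric graph serves
for both kinds of graphs, since only upper bounds for the number of temporal edges matter.

The reduction is carried out by an explicit program (`reduction`). It moves the input to high
addresses, writes the encoding of the graph from address `0` on, and erases the input and the
registers, so that a decision procedure for graphs starts in its own initial state
(`runs_reduction`). Its cost is counted in instructions on numbers with a bounded number of digits
(`Runs`); programs without loops are evaluated symbolically (`Runs.of_fits`), and loops are treated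
by induction. Negating the answer of the decision procedure gives an algorithm for satisfiability
in time `2 ^ ((1 - δ / 2) n)` up to polynomial factors, where `δ = min ε 1`
(`not_decidableInSoftTime`).
-/

namespace TemporalLowerBound

/-! ### Cost bounds for programs on states with finitely many nonzero registers -/

/-- A description of a machine state: the values of an initial segment of the registers (all later
registers hold zero), and the memory. -/
abbrev Config := List ℕ × (ℕ → ℕ)

/-- The machine state described by a configuration. -/
def Config.toState (s : Config) : State := ⟨fun r => s.1.getD r 0, s.2⟩

/-- All numbers in the configuration have at most `B` binary digits. -/
def Config.Bounded (B : ℕ) (s : Config) : Prop :=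
  (∀ r, s.1.getD r 0 < 2 ^ B) ∧ ∀ a, s.2 a < 2 ^ B

/-- Started in `s`, the program `p` halts in `s'`. If the numbers in `s` have at most `B` digits,
then so do those in `s'`, and the cost is at most that of `k` instructions on such numbers. -/
def Runs (B : ℕ) (p : Prog) (s s' : Config) (k : ℕ) : Prop :=
  s.Bounded B → s'.Bounded B ∧ ∃ t ≤ k * (2 * B + 1), Exec p s.toState s'.toState t

/-- The effect of a program without loops on a configuration. -/
def Prog.eval : Prog → Config → Config
  | .skip, s => s
  | .const d c, s => (s.1.set d c, s.2)
  | .arith o d a b, s => (s.1.set d (o.eval (s.1.getD a 0) (s.1.getD b 0)), s.2)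
  | .load d a, s => (s.1.set d (s.2 (s.1.getD a 0)), s.2)
  | .store a b, s => (s.1, Function.update s.2 (s.1.getD a 0) (s.1.getD b 0))
  | .seq p q, s => q.eval (p.eval s)
  | .cond r p q, s => if s.1.getD r 0 = 0 then q.eval s else p.eval s
  | .loop _ _, s => s

/-- The program has no loops, writes to listed registers only, and on bounded numbers never
produces a number with more than `B` digits. Differences, quotients and loaded numbers are not
mentioned, because they cannot exceed numbers that are already there. -/
def Prog.Fits (B : ℕ) : Prog → Config → Prop
  | .skip, _ => True
  | .const d c, s => d < s.1.length ∧ c < 2 ^ B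
  | .arith .add d a b, s => d < s.1.length ∧ s.1.getD a 0 + s.1.getD b 0 < 2 ^ B
  | .arith .mul d a b, s => d < s.1.length ∧ s.1.getD a 0 * s.1.getD b 0 < 2 ^ B
  | .arith .sub d _ _, s => d < s.1.length
  | .arith .div d _ _, s => d < s.1.length
  | .load d _, s => d < s.1.length
  | .store _ _, _ => True
  | .seq p q, s => p.Fits B s ∧ q.Fits B (p.eval s)
  | .cond r p q, s => if s.1.getD r 0 = 0 then q.Fits B s else p.Fits B s
  | .loop _ _, _ => False

/-- A bound for the number of instructions carried out by a program without loops. -/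
def Prog.steps : Prog → ℕ
  | .seq p q => p.steps + q.steps
  | .cond _ p q => 1 + p.steps + q.steps
  | _ => 1

theorem getD_set_eq_update {L : List ℕ} {d : ℕ} (hd : d < L.length) (x : ℕ) :
    (fun r => (L.set d x).getD r 0) = Function.update (fun r => L.getD r 0) d x := by
  funext r
  rcases eq_or_ne r d with rfl | h
  · simp [List.getD_eq_getElem?_getD, hd]
  · simp [List.getD_eq_getElem?_getD, Function.update_of_ne h, List.getElem?_set_ne h.symm]

theorem Config.toState_set {s : Config} {d : ℕ} (hd : d < s.1.length) (x : ℕ) :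
    Config.toState (s.1.set d x, s.2) = s.toState.setReg d x := by
  simp only [Config.toState, State.setReg, getD_set_eq_update hd]

theorem Config.Bounded.set {B : ℕ} {s : Config} (h : s.Bounded B) {d x : ℕ}
    (hd : d < s.1.length) (hx : x < 2 ^ B) : Config.Bounded B (s.1.set d x, s.2) := by
  refine ⟨fun r => ?_, h.2⟩
  rw [show (s.1.set d x).getD r 0 = _ from congrFun (getD_set_eq_update hd x) r]
  rcases eq_or_ne r d with rfl | hr
  · simpa using hx
  · simpa [Function.update_of_ne hr] using h.1 r

theorem Config.Bounded.size_reg {B : ℕ} {s : Config} (h : s.Bounded B) (r : ℕ) :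
    Nat.size (s.1.getD r 0) ≤ B := Nat.size_le.2 (h.1 r)

theorem Config.Bounded.size_mem {B : ℕ} {s : Config} (h : s.Bounded B) (a : ℕ) :
    Nat.size (s.2 a) ≤ B := Nat.size_le.2 (h.2 a)

theorem Runs.mono {B : ℕ} {p : Prog} {s s' : Config} {k k' : ℕ} (h : Runs B p s s' k)
    (hk : k ≤ k') : Runs B p s s' k' := fun hs =>
  let ⟨h1, t, ht, he⟩ := h hs
  ⟨h1, t, ht.trans (Nat.mul_le_mul_right _ hk), he⟩

theorem Runs.seq {B : ℕ} {p q : Prog} {s s₁ s₂ : Config} {k₁ k₂ : ℕ} (h₁ : Runs B p s s₁ k₁)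
    (h₂ : Runs B q s₁ s₂ k₂) : Runs B (.seq p q) s s₂ (k₁ + k₂) := by
  intro hs
  obtain ⟨hb₁, t₁, ht₁, he₁⟩ := h₁ hs
  obtain ⟨hb₂, t₂, ht₂, he₂⟩ := h₂ hb₁
  exact ⟨hb₂, t₁ + t₂, by rw [add_mul]; omega, .seq he₁ he₂⟩

theorem Runs.loop_true {B r : ℕ} {p : Prog} {s s₁ s₂ : Config} {k₁ k₂ : ℕ}
    (hr : s.1.getD r 0 ≠ 0) (h₁ : Runs B p s s₁ k₁) (h₂ : Runs B (.loop r p) s₁ s₂ k₂) :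
    Runs B (.loop r p) s s₂ (1 + k₁ + k₂) := by
  intro hs
  obtain ⟨hb₁, t₁, ht₁, he₁⟩ := h₁ hs
  obtain ⟨hb₂, t₂, ht₂, he₂⟩ := h₂ hb₁
  refine ⟨hb₂, _, ?_, .loop_true hr he₁ he₂⟩
  have : Nat.size (s.toState.reg r) ≤ B := hs.size_reg r
  simp only [add_mul]
  omega

theorem Runs.loop_false {B r : ℕ} {p : Prog} {s : Config} (hr : s.1.getD r 0 = 0) :
    Runs B (.loop r p) s s 1 := fun hs => ⟨hs, 1, by omega, .loop_false hr⟩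

/-- Programs without loops run as computed by `Prog.eval`. -/
theorem Runs.of_fits {B : ℕ} (p : Prog) (s : Config) (h : p.Fits B s) :
    Runs B p s (p.eval s) p.steps := by
  induction p generalizing s with
  | skip => exact fun hs => ⟨hs, 1, by simp [Prog.steps], .skip _⟩
  | const d c =>
    intro hs
    have := Nat.size_le.2 h.2
    refine ⟨hs.set h.1 h.2, 1 + Nat.size c, by simp only [Prog.steps]; omega, ?_⟩
    simp only [Prog.eval]
    rw [Config.toState_set h.1]
    exact .const d c _
  | arith o d a b =>
    intro hs
    have ha := hs.size_reg a
    have hb := hs.size_reg b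
    have hd : d < s.1.length := by cases o <;> simp only [Prog.Fits] at h <;> tauto
    have hv : o.eval (s.1.getD a 0) (s.1.getD b 0) < 2 ^ B := by
      cases o <;> simp only [Prog.Fits] at h
      · exact h.2
      · exact (Nat.sub_le _ _).trans_lt (hs.1 a)
      · exact h.2
      · exact (Nat.div_le_self _ _).trans_lt (hs.1 a)
    refine ⟨hs.set hd hv, 1 + Nat.size (s.1.getD a 0) + Nat.size (s.1.getD b 0),
      by simp only [Prog.steps]; omega, ?_⟩
    simp only [Prog.eval]
    rw [Config.toState_set hd]
    exact .arith o d a b _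
  | load d a =>
    intro hs
    have ha := hs.size_reg a
    have hb := hs.size_mem (s.1.getD a 0)
    refine ⟨hs.set h (hs.2 _), 1 + Nat.size (s.1.getD a 0) + Nat.size (s.2 (s.1.getD a 0)),
      by simp only [Prog.steps]; omega, ?_⟩
    simp only [Prog.eval]
    rw [Config.toState_set h]
    exact .load d a _
  | store a b =>
    intro hs
    have ha := hs.size_reg a
    have hb := hs.size_reg b
    refine ⟨⟨hs.1, fun c => ?_⟩, _, ?_, .store a b _⟩
    · simp only [Prog.eval, Function.update_apply]
      split_ifs
      · exact hs.1 b
      · exact hs.2 c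
    · change 1 + Nat.size (s.1.getD a 0) + Nat.size (s.1.getD b 0) ≤ _
      simp only [Prog.steps]; omega
  | seq p q hp hq => exact (hp s h.1).seq (hq _ h.2)
  | cond r p q hp hq =>
    intro hs
    have hr := hs.size_reg r
    simp only [Prog.Fits] at h
    simp only [Prog.eval, Prog.steps, add_mul]
    split_ifs at h ⊢ with h0
    · obtain ⟨hb, t, ht, he⟩ := hq s h hs
      exact ⟨hb, _, by omega, .cond_false h0 he⟩
    · obtain ⟨hb, t, ht, he⟩ := hp s h hs
      refine ⟨hb, _, ?_, .cond_true h0 he⟩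
      change 1 + Nat.size (s.1.getD r 0) + t ≤ _
      omega
  | loop r p => exact h.elim

theorem Runs.block {B k : ℕ} {p : Prog} {s s' : Config} (h : p.Fits B s) (he : p.eval s = s')
    (hk : p.steps ≤ k) : Runs B p s s' k := he ▸ (Runs.of_fits p s h).mono hk

/-- The programs of a list, one after the other. -/
def Prog.seqs : List Prog → Prog
  | [] => .skip
  | p :: l => .seq p (seqs l)

/-! ### Writing the output while the input is kept at high addresses -/

/-- The memory that holds the list `o` from address `0` on and the list `x` from address `D` on,
and zeros elsewhere. -/
def twoLists (o : List ℕ) (D : ℕ) (x : List ℕ) : ℕ → ℕ :=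
  fun a => if a < o.length then o.getD a 0 else if D ≤ a then x.getD (a - D) 0 else 0

theorem update_twoLists {o x : List ℕ} {D : ℕ} (v : ℕ) :
    Function.update (twoLists o D x) o.length v = twoLists (o ++ [v]) D x := by
  funext a
  rcases lt_trichotomy a o.length with ha | ha | ha
  · simp [twoLists, Function.update_of_ne ha.ne, ha, ha.trans (Nat.lt_succ_self _)]
  · subst ha; simp [twoLists]
  · have : ¬ a < o.length + 1 := by omega
    simp [twoLists, Function.update_of_ne ha.ne', this, ha.not_gt]

theorem twoLists_of_drop {o x l : List ℕ} {D i v : ℕ} (h : o.length ≤ D) (hx : x.drop i = v :: l) :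
    twoLists o D x (D + i) = v := by
  have h1 : ¬ D + i < o.length := by omega
  have : x[i]? = some v := by
    have := congrArg (·[0]?) hx
    simpa using this
  simp [twoLists, h1, this]

theorem drop_succ_of_drop {x l : List ℕ} {i v : ℕ} (hx : x.drop i = v :: l) :
    x.drop (i + 1) = l := by
  rw [← List.drop_drop, hx]; rfl

/-- Appends the values of the listed registers to the list that is being written; register `20`
holds its length, and register `1` the number `1`. -/
def pushAll : List ℕ → Prog
  | [] => .skip
  | r :: rs => .seq (.seq (.store 20 r) (.arith .add 20 20 1)) (pushAll rs)

theorem runs_pushAll {B D : ℕ} {x : List ℕ} (hD : D < 2 ^ B) (rs : List ℕ) :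
    ∀ (L o : List ℕ), L.getD 20 0 = o.length → L.getD 1 0 = 1 → 20 < L.length → 20 ∉ rs →
      o.length + rs.length ≤ D →
      Runs B (pushAll rs) (L, twoLists o D x)
        (L.set 20 (o.length + rs.length), twoLists (o ++ rs.map (L.getD · 0)) D x)
        (2 * rs.length + 1) := by
  induction rs with
  | nil =>
    intro L o h20 h1 hL hrs hlen
    refine Runs.block trivial ?_ (by simp [pushAll, Prog.steps])
    have : L.set 20 o.length = L := by
      rw [← h20, List.getD_eq_getElem _ _ hL]; simp
    simp [pushAll, Prog.eval, this]
  | cons r rs ih =>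
    intro L o h20 h1 hL hrs hlen
    simp only [List.mem_cons, not_or] at hrs
    simp only [List.length_cons] at hlen ⊢
    have hget : ∀ i, i ≠ 20 → (L.set 20 (o.length + 1)).getD i 0 = L.getD i 0 := by
      intro i hi
      have := congrFun (getD_set_eq_update hL (o.length + 1)) i
      simpa [Function.update_of_ne hi] using this
    have := ih (L.set 20 (o.length + 1)) (o ++ [L.getD r 0])
      (by simp [List.getD_eq_getElem?_getD, hL]) (by rw [hget 1 (by decide), h1]) (by simpa) hrs.2
      (by simp; omega)
    have hstep : Runs B (.seq (.store 20 r) (.arith .add 20 20 1)) (L, twoLists o D x)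
        (L.set 20 (o.length + 1), twoLists (o ++ [L.getD r 0]) D x) 2 := by
      refine Runs.block ?_ ?_ (by simp [Prog.steps])
      · simp only [Prog.Fits, Prog.eval, h20, h1, true_and]
        exact ⟨hL, by omega⟩
      · simp only [Prog.eval, h20, h1, ArithOp.eval]
        rw [update_twoLists]
    have hmap : rs.map ((L.set 20 (o.length + 1)).getD · 0) = rs.map (L.getD · 0) :=
      List.map_congr_left fun i hi => hget i (fun h => hrs.2 (h ▸ hi))
    rw [hmap] at this
    have := (hstep.seq this).mono (k' := 2 * (rs.length + 1) + 1) (by omega)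
    simp only [List.set_set, List.length_append, List.length_singleton, List.append_assoc,
      List.singleton_append] at this
    rw [show o.length + 1 + rs.length = o.length + (rs.length + 1) by omega] at this
    simpa [pushAll] using this

/-! ### The program that writes down the graph of a formula -/

/-- The quantities that stay fixed while the graph is written: the length of the input, the numbers
of clauses and of columns, the number of the hub, the length of the output, and the address to
which the input has been moved. -/
structure Params where
  len : ℕ
  m : ℕ
  K : ℕ
  hub : ℕ
  total : ℕ
  D : ℕ

/-- The registers of the program: the register `i` holds the number `i` for `1 ≤ i ≤ 12`, and the
register `13` holds zero. -/
def layout (a : Params) (out Q p pv ptr s leaf c j x y l w q e : ℕ) : List ℕ :=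
  [a.len, 1, 2, 3, 4, 5, 6, 7, 8, 9, 10, 11, 12, 0, a.m, a.K, a.K + 1, a.hub, a.total, a.D,
    out, Q, p, pv, ptr, s, leaf, c, j, x, y, l, w, q, e]

/-- Divides register `33` by two as often as register `32` says. -/
def shiftLoop : Prog :=
  .loop 32 (.seq (.arith .div 33 33 2) (.arith .sub 32 32 1))

/-- Reads a literal, and sets register `29` to `2` if the partial assignment in register `22`
makes it true. -/
def literalBody : Prog :=
  .seq (.seqs [.load 31 24, .arith .add 24 24 1, .arith .div 32 31 4, .arith .div 33 22 2])
    (.seq shiftLoop (.seqs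
      [.arith .div 34 33 2, .arith .mul 34 34 2, .arith .sub 33 33 34,
        .arith .add 33 33 25, .arith .add 33 33 25,
        .arith .div 34 31 4, .arith .mul 34 34 4, .arith .sub 31 31 34,
        .arith .sub 34 31 33, .arith .sub 33 33 31,
        .cond 34 .skip (.cond 33 .skip (.const 29 2)),
        .const 31 0, .const 33 0, .const 34 0, .arith .sub 30 30 1]))

/-- The partial assignment `p` makes the literal with the code `ℓ = 2 v + b` true: `p % 2` is the
parity of the variables to which `p` assigns values, and the value of such a variable `v` is the
digit number `v / 2` of `p / 2`. -/
def litTrue (p l : ℕ) : Bool := l % 4 = 2 * (p % 2) + p / 2 ^ (l / 4 + 1) % 2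

theorem runs_shiftLoop {B : ℕ} (a : Params) (out Q p pv ptr s leaf c j x y l e : ℕ) (f : ℕ → ℕ)
    (w : ℕ) : ∀ q, Runs B shiftLoop (layout a out Q p pv ptr s leaf c j x y l w q e, f)
      (layout a out Q p pv ptr s leaf c j x y l 0 (q / 2 ^ w) e, f) (3 * w + 1) := by
  induction w with
  | zero =>
    intro q
    rw [pow_zero, Nat.div_one]
    exact Runs.loop_false (by simp [layout])
  | succ w ih =>
    intro q
    have h := ih (q / 2)
    rw [Nat.div_div_eq_div_mul, ← pow_succ'] at h
    refine (Runs.loop_true (k₁ := 2) (by simp [layout]) (Runs.block ?_ rfl ?_) h).mono (by omega)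
    · simp [Prog.Fits, Prog.eval, layout]
    · simp [Prog.steps]

section

variable {B : ℕ} {a : Params} {xin o : List ℕ}

theorem runs_literalBody (hB : 7 ≤ B) (hD : a.D + xin.length + 1 < 2 ^ B)
    (hx : ∀ v ∈ xin, v < 2 ^ B) (ho : o.length ≤ a.D) (out Q p pv leaf c j x y i l : ℕ)
    (rest : List ℕ) (hp : p < 2 ^ B) (hi : xin.drop i = l :: rest) :
    Runs B literalBody
      (layout a out Q p pv (a.D + i) (p % 2) leaf c j x (y + 1) 0 0 0 0, twoLists o a.D xin)
      (layout a out Q p pv (a.D + (i + 1)) (p % 2) leaf c j (if litTrue p l then 2 else x) y 0 0 0 0,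
        twoLists o a.D xin) (3 * (l / 4) + 30) := by
  have hB' : 2 ^ 7 ≤ 2 ^ B := Nat.pow_le_pow_right (by decide) hB
  have hil : i < xin.length := by
    by_contra h
    rw [List.drop_eq_nil_of_le (by omega)] at hi
    cases hi
  have hl : l < 2 ^ B := hx l (List.mem_of_mem_drop (i := i) (by simp [hi]))
  have hload := twoLists_of_drop ho hi
  have h1 : Runs B (.seqs [.load 31 24, .arith .add 24 24 1, .arith .div 32 31 4,
      .arith .div 33 22 2])
      (layout a out Q p pv (a.D + i) (p % 2) leaf c j x (y + 1) 0 0 0 0, twoLists o a.D xin)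
      (layout a out Q p pv (a.D + (i + 1)) (p % 2) leaf c j x (y + 1) l (l / 4) (p / 2) 0,
        twoLists o a.D xin) 5 := by
    refine Runs.block ?_ ?_ ?_
    · simp [Prog.Fits, Prog.eval, Prog.seqs, layout, hload]; omega
    · simp [Prog.eval, Prog.seqs, layout, hload, ArithOp.eval, add_assoc]
    · simp [Prog.steps, Prog.seqs]
  have h2 := runs_shiftLoop (B := B) a out Q p pv (a.D + (i + 1)) (p % 2) leaf c j x (y + 1) l 0
    (twoLists o a.D xin) (l / 4) (p / 2)
  rw [Nat.div_div_eq_div_mul, ← pow_succ'] at h2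
  set z := p / 2 ^ (l / 4 + 1) with hz
  have hzp : z ≤ p := Nat.div_le_self _ _
  refine (h1.seq (h2.seq (Runs.block (k := 20) ?_ ?_ ?_))).mono (by omega)
  · simp [Prog.Fits, Prog.eval, Prog.seqs, layout, ArithOp.eval]
    refine ⟨by omega, by omega, by omega, by omega, ?_⟩
    split_ifs <;> simp <;> omega
  · have e1 : z - z / 2 * 2 + p % 2 + p % 2 = 2 * (p % 2) + z % 2 := by omega
    have e2 : l - l / 4 * 4 = l % 4 := by omega
    simp only [Prog.eval, Prog.seqs, layout, ArithOp.eval, litTrue, ← hz]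
    simp [e1, e2]
    split_ifs <;> simp <;> omega
  · simp [Prog.steps, Prog.seqs]

theorem runs_literalLoop (hB : 7 ≤ B) (hD : a.D + xin.length + 1 < 2 ^ B)
    (hx : ∀ v ∈ xin, v < 2 ^ B) (ho : o.length ≤ a.D) (out Q p pv leaf c j : ℕ)
    (hp : p < 2 ^ B) (rest : List ℕ) {W : ℕ} (lits : List ℕ) (hW : ∀ l ∈ lits, l ≤ 4 * W) :
    ∀ x i, xin.drop i = lits ++ rest →
      Runs B (.loop 30 literalBody)
        (layout a out Q p pv (a.D + i) (p % 2) leaf c j x lits.length 0 0 0 0,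
          twoLists o a.D xin)
        (layout a out Q p pv (a.D + (i + lits.length)) (p % 2) leaf c j
          (if lits.any (litTrue p) then 2 else x) 0 0 0 0 0, twoLists o a.D xin)
        (lits.length * (3 * W + 31) + 1) := by
  induction lits with
  | nil => intro x i _; exact (Runs.loop_false (by simp [layout])).mono (by simp)
  | cons l lits ih =>
    intro x i hi
    have h1 := runs_literalBody hB hD hx ho out Q p pv leaf c j x lits.length i l _ hp hi
    have h2 := ih (fun l' h => hW l' (by simp [h])) (if litTrue p l then 2 else x) (i + 1)
      (drop_succ_of_drop hi)
    have h3 := (Runs.loop_true (by simp [layout]) h1 h2).mono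
      (k' := (lits.length + 1) * (3 * W + 31) + 1)
      (by have := hW l (by simp); rw [add_mul]; omega)
    have e : (if lits.any (litTrue p) then 2 else if litTrue p l then 2 else x) =
        if (l :: lits).any (litTrue p) then 2 else x := by
      rw [List.any_cons]
      cases lits.any (litTrue p) <;> cases litTrue p l <;> rfl
    rw [add_assoc i, add_comm 1, e] at h3
    exact h3

/-! ### The temporal edges at a leaf -/

/-- The neighbours of the leaf in row `p` and column `j`, with the times at which the edges are
available: the neighbours are the vertex of row `p`, the vertex of column `j`, and the hub. -/
def incidences (pv c hub x : ℕ) : List (ℕ × ℕ) :=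
  [(pv, 6), (pv, 9), (c, 1), (c, x), (c, x + 1), (c, 12), (hub, 4), (hub, 5), (hub, 10), (hub, 11)]

/-- The temporal edges at a leaf, in both directions, as they are written into the memory. -/
def cell (leaf pv c hub x : ℕ) : List ℕ :=
  (incidences pv c hub x).flatMap fun e => [leaf, e.1, e.2, e.1, leaf, e.2]

/-- The registers that hold the entries of `cell`. -/
def cellRegs : List ℕ :=
  [(23, 6), (23, 9), (27, 1), (27, 29), (27, 30), (27, 12), (17, 4), (17, 5), (17, 10),
    (17, 11)].flatMap fun e => [26, e.1, e.2, e.1, 26, e.2]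

theorem length_cell (leaf pv c hub x : ℕ) : (cell leaf pv c hub x).length = 60 := rfl

/-- Writes the temporal edges at a leaf, and moves on to the next leaf of the row. -/
def emit : Prog :=
  .seq (.arith .add 30 29 1) (.seq (pushAll cellRegs) (.seqs
    [.const 29 0, .const 30 0, .arith .add 26 26 1, .arith .add 27 27 1]))

/-- The temporal edges at consecutive leaves of a row, for the listed times. -/
def rowOut (pv hub : ℕ) : ℕ → ℕ → List ℕ → List ℕ
  | _, _, [] => []
  | leaf, c, x :: xs => cell leaf pv c hub x ++ rowOut pv hub (leaf + 1) (c + 1) xs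

theorem runs_emit (hD : a.D + xin.length + 1 < 2 ^ B) (ho : o.length + 60 ≤ a.D)
    (Q p pv ptr s leaf c j x y : ℕ) (hx : x + 1 < 2 ^ B) (hl : leaf + 1 < 2 ^ B)
    (hc : c + 1 < 2 ^ B) :
    Runs B emit (layout a o.length Q p pv ptr s leaf c j x y 0 0 0 0, twoLists o a.D xin)
      (layout a (o.length + 60) Q p pv ptr s (leaf + 1) (c + 1) j 0 0 0 0 0 0,
        twoLists (o ++ cell leaf pv c a.hub x) a.D xin) 130 := by
  have h1 : Runs B (.arith .add 30 29 1)
      (layout a o.length Q p pv ptr s leaf c j x y 0 0 0 0, twoLists o a.D xin)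
      (layout a o.length Q p pv ptr s leaf c j x (x + 1) 0 0 0 0, twoLists o a.D xin) 1 := by
    refine Runs.block ?_ rfl (by simp [Prog.steps])
    simpa [Prog.Fits, layout] using hx
  have h2 := runs_pushAll (B := B) (D := a.D) (x := xin) (by omega) cellRegs
    (layout a o.length Q p pv ptr s leaf c j x (x + 1) 0 0 0 0) o rfl rfl (by simp [layout])
    (by decide) ho
  refine (h1.seq (h2.seq (Runs.block (k := 5) ?_ rfl ?_))).mono (by decide)
  · simp [Prog.Fits, Prog.eval, Prog.seqs, layout]; omega
  · simp [Prog.steps, Prog.seqs]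

/-! ### The loops over the clauses and over the partial assignments -/

/-- Reads a clause, and writes the temporal edges at its leaf in the row. -/
def clauseBody : Prog :=
  .seq (.seqs [.const 29 7, .load 30 24, .arith .add 24 24 1])
    (.seq (.loop 30 literalBody) (.seq emit (.arith .sub 28 28 1)))

/-- The time that tells whether the partial assignment `p` makes a literal of the clause true. -/
def cellTime (p : ℕ) (c : List ℕ) : ℕ := if c.any (litTrue p) then 2 else 7

/-- A clause as it is stored in the memory. -/
def encodeClause (c : List ℕ) : List ℕ := c.length :: c

theorem length_rowOut (pv hub : ℕ) (xs : List ℕ) :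
    ∀ leaf c, (rowOut pv hub leaf c xs).length = 60 * xs.length := by
  induction xs with
  | nil => simp [rowOut]
  | cons x xs ih => intro leaf c; simp [rowOut, ih, length_cell]; ring

theorem rowOut_append (pv hub : ℕ) (xs ys : List ℕ) : ∀ leaf c,
    rowOut pv hub leaf c (xs ++ ys) =
      rowOut pv hub leaf c xs ++ rowOut pv hub (leaf + xs.length) (c + xs.length) ys := by
  induction xs with
  | nil => simp [rowOut]
  | cons x xs ih => intro leaf c; simp [rowOut, ih, add_assoc, add_comm 1]

theorem cellTime_lt (hB : 7 ≤ B) (p : ℕ) (c : List ℕ) : cellTime p c + 1 < 2 ^ B := by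
  have hB' : 2 ^ 7 ≤ 2 ^ B := Nat.pow_le_pow_right (by decide) hB
  unfold cellTime
  split_ifs <;> omega

theorem runs_clauseLoop (hB : 7 ≤ B) (hD : a.D + xin.length + 1 < 2 ^ B)
    (hx : ∀ v ∈ xin, v < 2 ^ B) (Q p pv : ℕ) (hp : p < 2 ^ B) {W k : ℕ} (cs : List (List ℕ))
    (hW : ∀ c ∈ cs, c.length ≤ k ∧ ∀ l ∈ c, l ≤ 4 * W) :
    ∀ (o : List ℕ) (leaf c i : ℕ), xin.drop i = cs.flatMap encodeClause →
      o.length + 60 * cs.length ≤ a.D → leaf + cs.length < 2 ^ B → c + cs.length < 2 ^ B →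
      Runs B (.loop 28 clauseBody)
        (layout a o.length Q p pv (a.D + i) (p % 2) leaf c cs.length 0 0 0 0 0 0,
          twoLists o a.D xin)
        (layout a (o.length + 60 * cs.length) Q p pv (a.D + (i + (cs.flatMap encodeClause).length))
          (p % 2) (leaf + cs.length) (c + cs.length) 0 0 0 0 0 0 0,
          twoLists (o ++ rowOut pv a.hub leaf c (cs.map (cellTime p))) a.D xin)
        (cs.length * (k * (3 * W + 31) + 140) + 1) := by
  have hB' : 2 ^ 7 ≤ 2 ^ B := Nat.pow_le_pow_right (by decide) hB
  induction cs with
  | nil =>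
    intro o leaf c i _ _ _ _
    refine Runs.mono (k := 1) ?_ (by simp)
    simpa [rowOut] using Runs.loop_false (by simp [layout])
  | cons c₀ cs ih =>
    intro o leaf c i hi ho hl hc
    simp only [List.length_cons] at ho hl hc ⊢
    rw [List.flatMap_cons, encodeClause, List.cons_append] at hi
    have hil : i < xin.length := by
      by_contra h
      rw [List.drop_eq_nil_of_le (by omega)] at hi
      cases hi
    have hload := twoLists_of_drop (o := o) (D := a.D) (by omega) hi
    have h1 : Runs B (.seqs [.const 29 7, .load 30 24, .arith .add 24 24 1])
        (layout a o.length Q p pv (a.D + i) (p % 2) leaf c (cs.length + 1) 0 0 0 0 0 0,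
          twoLists o a.D xin)
        (layout a o.length Q p pv (a.D + (i + 1)) (p % 2) leaf c (cs.length + 1) 7 c₀.length 0 0 0 0,
          twoLists o a.D xin) 4 := by
      refine Runs.block ?_ ?_ ?_
      · simp [Prog.Fits, Prog.eval, Prog.seqs, layout]; omega
      · simp [Prog.eval, Prog.seqs, layout, hload, ArithOp.eval, add_assoc]
      · simp [Prog.steps, Prog.seqs]
    have hi' := drop_succ_of_drop hi
    have h2 := runs_literalLoop (a := a) (o := o) hB hD hx (by omega) o.length Q p pv leaf c
      (cs.length + 1) hp _ c₀ (hW c₀ (by simp)).2 7 (i + 1) hi'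
    have h3 := runs_emit (a := a) (o := o) hD (by omega) Q p pv (a.D + (i + 1 + c₀.length)) (p % 2)
      leaf c (cs.length + 1) (cellTime p c₀) 0 (cellTime_lt hB p c₀) (by omega) (by omega)
    have h4 : Runs B (.arith .sub 28 28 1)
        (layout a (o.length + 60) Q p pv (a.D + (i + 1 + c₀.length)) (p % 2) (leaf + 1) (c + 1)
          (cs.length + 1) 0 0 0 0 0 0, twoLists (o ++ cell leaf pv c a.hub (cellTime p c₀)) a.D xin)
        (layout a (o.length + 60) Q p pv (a.D + (i + 1 + c₀.length)) (p % 2) (leaf + 1) (c + 1)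
          cs.length 0 0 0 0 0 0, twoLists (o ++ cell leaf pv c a.hub (cellTime p c₀)) a.D xin)
        1 := by
      refine Runs.block ?_ rfl (by simp [Prog.steps])
      simp [Prog.Fits, layout]
    have h5 := ih (fun c' h => hW c' (by simp [h])) (o ++ cell leaf pv c a.hub (cellTime p c₀))
      (leaf + 1) (c + 1) (i + 1 + c₀.length)
      (by rw [← List.drop_drop, hi', List.drop_left])
      (by simp [length_cell]; omega) (by omega) (by omega)
    rw [List.length_append, length_cell] at h5
    have h6 := Runs.loop_true (r := 28) (by simp [layout]) (h1.seq (h2.seq (h3.seq h4))) h5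
    have h7 := h6.mono (k' := (cs.length + 1) * (k * (3 * W + 31) + 140) + 1) (by
      have := Nat.mul_le_mul_right (3 * W + 31) (hW c₀ (by simp)).1
      rw [add_mul (cs.length)]; omega)
    have e : i + 1 + c₀.length + (cs.flatMap encodeClause).length =
        i + ((c₀ :: cs).flatMap encodeClause).length := by
      simp [encodeClause]; ring
    rw [e, List.append_assoc, show o.length + 60 + 60 * cs.length = o.length + 60 * (cs.length + 1)
      by ring, add_assoc leaf, add_assoc c, add_comm 1] at h7
    exact h7

/-- The times that occur in row `p`: those for the clauses, and those for two additional columns,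
which are treated as clauses that are falsified by the partial assignments of one parity. -/
def rowTimes (p : ℕ) (cs : List (List ℕ)) : List ℕ :=
  cs.map (cellTime p) ++ [7 - 5 * (p % 2), 2 + 5 * (p % 2)]

/-- Writes the temporal edges at the leaves of a row. -/
def rowBody : Prog :=
  .seq (.seqs [.const 24 2, .arith .add 24 24 19, .arith .div 25 22 2, .arith .mul 25 25 2,
      .arith .sub 25 22 25, .arith .sub 26 23 15, .arith .sub 27 17 15, .arith .add 28 14 13])
    (.seq (.loop 28 clauseBody)
    (.seq (.seqs [.arith .mul 30 25 5, .arith .sub 29 7 30])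
    (.seq emit
    (.seq (.seqs [.arith .mul 30 25 5, .arith .add 29 2 30])
    (.seq emit
      (.seqs [.const 24 0, .const 25 0, .const 26 0, .const 27 0, .arith .add 22 22 1,
        .arith .add 23 23 16, .arith .sub 21 21 1]))))))

/-- The temporal edges at the leaves of row `p` in a graph with the given number of columns and the
given hub. -/
def row (K hub : ℕ) (cs : List (List ℕ)) (p : ℕ) : List ℕ :=
  rowOut (p * (K + 1) + K) hub (p * (K + 1)) (hub - K) (rowTimes p cs)

theorem length_row (K hub : ℕ) (cs : List (List ℕ)) (p : ℕ) :
    (row K hub cs p).length = 60 * (cs.length + 2) := by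
  simp [row, length_rowOut, rowTimes]

theorem runs_rowBody (hB : 7 ≤ B) (hD : a.D + xin.length + 1 < 2 ^ B)
    (hx : ∀ v ∈ xin, v < 2 ^ B) {W k n : ℕ} {cs : List (List ℕ)}
    (hW : ∀ c ∈ cs, c.length ≤ k ∧ ∀ l ∈ c, l ≤ 4 * W)
    (hxin : xin = n :: cs.length :: cs.flatMap encodeClause)
    (hm : a.m = cs.length) (hK : a.K = cs.length + 2) (hhub : a.hub + 1 < 2 ^ B) (Q p : ℕ)
    (hKh : a.K ≤ a.hub)
    (hp : (p + 1) * (a.K + 1) + a.K < 2 ^ B) (ho : o.length + 60 * a.K ≤ a.D) :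
    Runs B rowBody
      (layout a o.length (Q + 1) p (p * (a.K + 1) + a.K) 0 0 0 0 0 0 0 0 0 0 0,
        twoLists o a.D xin)
      (layout a (o.length + 60 * a.K) Q (p + 1) ((p + 1) * (a.K + 1) + a.K) 0 0 0 0 0 0 0 0 0 0 0,
        twoLists (o ++ row a.K a.hub cs p) a.D xin)
      (cs.length * (k * (3 * W + 31) + 140) + 300) := by
  have hB' : 2 ^ 7 ≤ 2 ^ B := Nat.pow_le_pow_right (by decide) hB
  have hlen : 2 ≤ xin.length := by rw [hxin]; simp
  have hpp : (p + 1) * (a.K + 1) = p * (a.K + 1) + a.K + 1 := by ring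
  have hpK : p ≤ p * (a.K + 1) := Nat.le_mul_of_pos_right _ (by omega)
  have h1 : Runs B (.seqs [.const 24 2, .arith .add 24 24 19, .arith .div 25 22 2,
      .arith .mul 25 25 2, .arith .sub 25 22 25, .arith .sub 26 23 15, .arith .sub 27 17 15,
      .arith .add 28 14 13])
      (layout a o.length (Q + 1) p (p * (a.K + 1) + a.K) 0 0 0 0 0 0 0 0 0 0 0,
        twoLists o a.D xin)
      (layout a o.length (Q + 1) p (p * (a.K + 1) + a.K) (a.D + 2) (p % 2) (p * (a.K + 1))
        (a.hub - a.K) cs.length 0 0 0 0 0 0, twoLists o a.D xin) 9 := by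
    refine Runs.block ?_ ?_ ?_
    · simp [Prog.Fits, Prog.eval, Prog.seqs, layout, ArithOp.eval]; omega
    · have : p - p / 2 * 2 = p % 2 := by omega
      simp [Prog.eval, Prog.seqs, layout, ArithOp.eval, hm, this, add_comm]
    · simp [Prog.steps, Prog.seqs]
  have h2 := runs_clauseLoop (a := a) hB hD hx (Q + 1) p (p * (a.K + 1) + a.K) (by omega) cs hW o
    (p * (a.K + 1)) (a.hub - a.K) 2 (by rw [hxin]; rfl) (by omega) (by omega) (by omega)
  set o₁ := o ++ rowOut (p * (a.K + 1) + a.K) a.hub (p * (a.K + 1)) (a.hub - a.K)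
    (cs.map (cellTime p)) with ho₁
  have hl₁ : o.length + 60 * cs.length = o₁.length := by simp [ho₁, length_rowOut]
  rw [hl₁] at h2
  set ptr := a.D + (2 + (cs.flatMap encodeClause).length)
  have h3 : Runs B (.seqs [.arith .mul 30 25 5, .arith .sub 29 7 30])
      (layout a o₁.length (Q + 1) p (p * (a.K + 1) + a.K) ptr (p % 2) (p * (a.K + 1) + cs.length)
        (a.hub - a.K + cs.length) 0 0 0 0 0 0 0, twoLists o₁ a.D xin)
      (layout a o₁.length (Q + 1) p (p * (a.K + 1) + a.K) ptr (p % 2) (p * (a.K + 1) + cs.length)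
        (a.hub - a.K + cs.length) 0 (7 - 5 * (p % 2)) (p % 2 * 5) 0 0 0 0, twoLists o₁ a.D xin)
      3 := by
    refine Runs.block ?_ ?_ ?_
    · simp [Prog.Fits, Prog.eval, Prog.seqs, layout]; omega
    · simp [Prog.eval, Prog.seqs, layout, ArithOp.eval, mul_comm]
    · simp [Prog.steps, Prog.seqs]
  have h4 := runs_emit (a := a) (o := o₁) hD (by omega) (Q + 1) p (p * (a.K + 1) + a.K) ptr (p % 2)
    (p * (a.K + 1) + cs.length) (a.hub - a.K + cs.length) 0 (7 - 5 * (p % 2)) (p % 2 * 5) (by omega)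
    (by omega) (by omega)
  set o₂ := o₁ ++ cell (p * (a.K + 1) + cs.length) (p * (a.K + 1) + a.K) (a.hub - a.K + cs.length)
    a.hub (7 - 5 * (p % 2)) with ho₂
  have hl₂ : o₁.length + 60 = o₂.length := by simp [ho₂, length_cell]
  rw [hl₂] at h4
  have h5 : Runs B (.seqs [.arith .mul 30 25 5, .arith .add 29 2 30])
      (layout a o₂.length (Q + 1) p (p * (a.K + 1) + a.K) ptr (p % 2)
        (p * (a.K + 1) + cs.length + 1) (a.hub - a.K + cs.length + 1) 0 0 0 0 0 0 0,
        twoLists o₂ a.D xin)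
      (layout a o₂.length (Q + 1) p (p * (a.K + 1) + a.K) ptr (p % 2)
        (p * (a.K + 1) + cs.length + 1) (a.hub - a.K + cs.length + 1) 0 (2 + 5 * (p % 2))
        (p % 2 * 5) 0 0 0 0, twoLists o₂ a.D xin)
      3 := by
    refine Runs.block ?_ ?_ ?_
    · simp [Prog.Fits, Prog.eval, Prog.seqs, layout, ArithOp.eval]; omega
    · simp [Prog.eval, Prog.seqs, layout, ArithOp.eval, mul_comm]
    · simp [Prog.steps, Prog.seqs]
  have h6 := runs_emit (a := a) (o := o₂) hD (by omega) (Q + 1) p (p * (a.K + 1) + a.K) ptr (p % 2)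
    (p * (a.K + 1) + cs.length + 1) (a.hub - a.K + cs.length + 1) 0 (2 + 5 * (p % 2)) (p % 2 * 5)
    (by omega) (by omega) (by omega)
  have ho₃ : o₂ ++ cell (p * (a.K + 1) + cs.length + 1) (p * (a.K + 1) + a.K)
      (a.hub - a.K + cs.length + 1) a.hub (2 + 5 * (p % 2)) = o ++ row a.K a.hub cs p := by
    simp [ho₂, ho₁, row, rowTimes, rowOut_append, rowOut]
  rw [ho₃] at h6
  refine (h1.seq (h2.seq (h3.seq (h4.seq (h5.seq (h6.seq (Runs.block (k := 8) ?_ ?_ ?_))))))).mono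
    (by omega)
  · simp [Prog.Fits, Prog.eval, Prog.seqs, layout, ArithOp.eval]; omega
  · simp [Prog.eval, Prog.seqs, layout, ArithOp.eval]
    omega
  · simp [Prog.steps, Prog.seqs]

theorem runs_rowLoop (hB : 7 ≤ B) (hD : a.D + xin.length + 1 < 2 ^ B)
    (hx : ∀ v ∈ xin, v < 2 ^ B) {W k n : ℕ} {cs : List (List ℕ)}
    (hW : ∀ c ∈ cs, c.length ≤ k ∧ ∀ l ∈ c, l ≤ 4 * W)
    (hxin : xin = n :: cs.length :: cs.flatMap encodeClause)
    (hm : a.m = cs.length) (hK : a.K = cs.length + 2) (hhub : a.hub + 1 < 2 ^ B)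
    (hKh : a.K ≤ a.hub) (Q : ℕ) :
    ∀ (p : ℕ) (o : List ℕ), (p + Q) * (a.K + 1) + a.K < 2 ^ B → o.length + 60 * a.K * Q ≤ a.D →
      Runs B (.loop 21 rowBody)
        (layout a o.length Q p (p * (a.K + 1) + a.K) 0 0 0 0 0 0 0 0 0 0 0, twoLists o a.D xin)
        (layout a (o.length + 60 * a.K * Q) 0 (p + Q) ((p + Q) * (a.K + 1) + a.K)
          0 0 0 0 0 0 0 0 0 0 0,
          twoLists (o ++ (List.range' p Q).flatMap (row a.K a.hub cs)) a.D xin)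
        (Q * (cs.length * (k * (3 * W + 31) + 140) + 301) + 1) := by
  induction Q with
  | zero =>
    intro p o _ _
    refine Runs.mono (k := 1) ?_ (by simp)
    simpa using Runs.loop_false (by simp [layout])
  | succ Q ih =>
    intro p o hp ho
    have e1 : p + 1 + Q = p + (Q + 1) := by omega
    have e2 : 60 * a.K * (Q + 1) = 60 * a.K + 60 * a.K * Q := by ring
    have hp' : (p + 1) * (a.K + 1) ≤ (p + (Q + 1)) * (a.K + 1) := Nat.mul_le_mul_right _ (by omega)
    have h1 := runs_rowBody (a := a) (o := o) hB hD hx hW hxin hm hK hhub Q p hKh (by omega)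
      (by omega)
    have hl : o.length + 60 * a.K = (o ++ row a.K a.hub cs p).length := by simp [length_row, hK]
    rw [hl] at h1
    have h2 := ih (p + 1) (o ++ row a.K a.hub cs p) (by rw [e1]; exact hp) (by omega)
    have h3 := (Runs.loop_true (r := 21) (by simp [layout]) h1 h2).mono
      (k' := (Q + 1) * (cs.length * (k * (3 * W + 31) + 140) + 301) + 1)
      (by rw [add_mul Q]; omega)
    rw [← hl, e1, add_assoc, ← e2, List.append_assoc, ← List.flatMap_cons] at h3
    exact h3

end

/-! ### Moving the input, and removing it in the end -/

/-- The memory while the list `x` is being moved by `D`: the first `i` entries are still to be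
moved. -/
def halfMoved (x : List ℕ) (D i : ℕ) : ℕ → ℕ :=
  fun a => if a < i then x.getD a 0 else if D + i ≤ a then x.getD (a - D) 0 else 0

theorem halfMoved_length {x : List ℕ} {D : ℕ} :
    halfMoved x D x.length = fun a => x.getD a 0 := by
  funext a
  unfold halfMoved
  split_ifs with h1 h2
  · rfl
  · rw [List.getD_eq_default _ _ (by omega), List.getD_eq_default _ _ (by omega)]
  · rw [List.getD_eq_default _ _ (by omega)]

theorem halfMoved_zero {x : List ℕ} {D : ℕ} : halfMoved x D 0 = twoLists [] D x := by
  funext a; simp [halfMoved, twoLists]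

theorem update_halfMoved {x : List ℕ} {D i : ℕ} (hD : i < D) :
    Function.update (Function.update (halfMoved x D (i + 1)) (D + i) (halfMoved x D (i + 1) i)) i 0
      = halfMoved x D i := by
  funext a
  simp only [Function.update_apply, halfMoved]
  split_ifs <;> first | rfl | omega | skip
  subst_vars
  simp

/-- Moves the input to the address in register `19`; register `25` holds the number of entries that
are still to be moved. -/
def moveLoop : Prog :=
  .loop 25 (.seqs [.arith .sub 25 25 1, .load 26 25, .arith .add 27 19 25, .store 27 26,
    .store 25 13, .const 26 0, .const 27 0])

theorem runs_moveLoop {B : ℕ} (a : Params) (x : List ℕ) (out Q p pv ptr : ℕ) :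
    ∀ i, a.D + i < 2 ^ B → i ≤ a.D →
      Runs B moveLoop (layout a out Q p pv ptr i 0 0 0 0 0 0 0 0 0, halfMoved x a.D i)
        (layout a out Q p pv ptr 0 0 0 0 0 0 0 0 0 0, halfMoved x a.D 0) (9 * i + 1) := by
  intro i
  induction i with
  | zero => intro _ _; exact Runs.loop_false (by simp [layout])
  | succ i ih =>
    intro h1 h2
    refine (Runs.loop_true (k₁ := 8) (by simp [layout]) (Runs.block ?_ ?_ ?_)
      (ih (by omega) (by omega))).mono (by omega)
    · simp [Prog.Fits, Prog.eval, Prog.seqs, layout, ArithOp.eval]; omega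
    · simp [Prog.eval, Prog.seqs, layout, ArithOp.eval]
      exact update_halfMoved (by omega)
    · simp [Prog.steps, Prog.seqs]

theorem update_twoLists_take {o x : List ℕ} {D i : ℕ} (hD : o.length ≤ D) :
    Function.update (twoLists o D (x.take (i + 1))) (D + i) 0 = twoLists o D (x.take i) := by
  funext a
  simp only [Function.update_apply, twoLists, List.getD_eq_getElem?_getD, List.getElem?_take]
  split_ifs <;> first | rfl | omega

/-- Removes the moved input; register `0` holds the number of entries that are still there. -/
def clearLoop : Prog :=
  .loop 0 (.seqs [.arith .sub 0 0 1, .arith .add 24 19 0, .store 24 13, .const 24 0])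

theorem runs_clearLoop {B : ℕ} (a : Params) (x o : List ℕ) (ho : o.length ≤ a.D)
    (out Q p pv : ℕ) :
    ∀ i, a.D + i < 2 ^ B →
      Runs B clearLoop
        (layout { a with len := i } out Q p pv 0 0 0 0 0 0 0 0 0 0 0, twoLists o a.D (x.take i))
        (layout { a with len := 0 } out Q p pv 0 0 0 0 0 0 0 0 0 0 0, fun c => o.getD c 0)
        (6 * i + 1) := by
  intro i
  induction i with
  | zero =>
    intro _
    have : twoLists o a.D (x.take 0) = fun c => o.getD c 0 := by
      funext c
      simp only [twoLists, List.take_zero]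
      split_ifs <;> simp_all
    rw [this]
    exact Runs.loop_false (by simp [layout])
  | succ i ih =>
    intro h1
    refine (Runs.loop_true (k₁ := 5) (by simp [layout]) (Runs.block ?_ ?_ ?_)
      (ih (by omega))).mono (by omega)
    · simp [Prog.Fits, Prog.eval, Prog.seqs, layout, ArithOp.eval]; omega
    · simp [Prog.eval, Prog.seqs, layout, ArithOp.eval]
      exact update_twoLists_take ho
    · simp [Prog.steps, Prog.seqs]

/-! ### The whole reduction program -/

/-- The number of partial assignments for formulas with `n` variables: there are `2 ^ ⌈n / 2⌉` for
the variables of each parity. -/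
def numPartial (n : ℕ) : ℕ := 2 * 2 ^ ((n + 1) / 2)

/-- The encoding of the graph for a formula with `n` variables and the given clauses. -/
def graphOut (n : ℕ) (cs : List (List ℕ)) : List ℕ :=
  let Q := numPartial n
  let K := cs.length + 2
  let hub := Q * (K + 1) + K
  (hub + 1) :: 12 :: Q * K * 20 :: (List.range Q).flatMap (row K hub cs)

/-- Doubles register `21` as often as register `22` says. -/
def doubleLoop : Prog :=
  .loop 22 (.seq (.arith .add 21 21 21) (.arith .sub 22 22 1))

/-- Loads the constants, and computes the number of digits of a partial assignment. -/
def preamble : Prog :=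
  .seqs [.const 1 1, .const 2 2, .const 3 3, .const 4 4, .const 5 5, .const 6 6, .const 7 7,
    .const 8 8, .const 9 9, .const 10 10, .const 11 11, .const 12 12, .load 22 13, .load 14 1,
    .arith .add 22 22 1, .arith .div 22 22 2, .const 21 2]

/-- Computes the sizes of the graph and of its encoding from the number of partial assignments. -/
def computeSizes : Prog :=
  .seqs [.arith .add 15 14 2, .arith .add 16 15 1, .arith .mul 17 21 16, .arith .add 17 17 15,
    .arith .mul 23 21 15, .const 24 20, .arith .mul 23 23 24, .arith .mul 18 23 3,
    .arith .add 18 18 3, .arith .add 19 18 0, .arith .add 24 17 1, .arith .add 25 0 13]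

/-- The sizes for an input of length `len` with `m` clauses, `K` columns and `Q` partial
assignments. -/
def sizeParams (len m K Q : ℕ) : Params :=
  ⟨len, m, K, Q * (K + 1) + K, Q * K * 20 * 3 + 3, Q * K * 20 * 3 + 3 + len⟩

/-- Puts the length of the output into register `0`, and zeros into all other registers. -/
def cleanup : Prog :=
  .seqs [.arith .add 0 18 13, .const 1 0, .const 2 0, .const 3 0, .const 4 0, .const 5 0,
      .const 6 0, .const 7 0, .const 8 0, .const 9 0, .const 10 0, .const 11 0, .const 12 0,
      .const 14 0, .const 15 0, .const 16 0, .const 17 0, .const 18 0, .const 19 0, .const 20 0,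
      .const 22 0, .const 23 0]

/-- The reduction: given a formula, it leaves the memory with the encoding of the graph, and resets
all registers, so that a decision procedure for graphs can take over. -/
def reduction : Prog :=
  .seq preamble
  (.seq doubleLoop
  (.seq computeSizes
  (.seq moveLoop
  (.seq (pushAll [24, 12, 23])
  (.seq (.seqs [.const 24 0, .arith .add 23 15 13])
  (.seq (.loop 21 rowBody)
  (.seq clearLoop
    cleanup)))))))

/-- The state at the beginning, and at the moment when the decision procedure takes over. -/
def inputConfig (x : List ℕ) : Config :=
  (x.length :: List.replicate 34 0, fun a => x.getD a 0)

theorem toState_inputConfig (x : List ℕ) : (inputConfig x).toState = initState x := by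
  simp only [Config.toState, inputConfig, initState, State.mk.injEq, and_true]
  funext r
  cases r with
  | zero => rfl
  | succ r =>
    rw [List.getD_cons_succ, if_neg (Nat.succ_ne_zero r), List.getD_eq_getElem?_getD,
      List.getElem?_replicate]
    split_ifs <;> rfl

theorem runs_preamble {B n m : ℕ} {x l : List ℕ} (hB : 7 ≤ B) (hx : x = n :: m :: l)
    (hn : n + 1 < 2 ^ B) :
    Runs B preamble (inputConfig x)
      ([x.length, 1, 2, 3, 4, 5, 6, 7, 8, 9, 10, 11, 12, 0, m, 0, 0, 0, 0, 0, 0, 2,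
        (n + 1) / 2, 0, 0, 0, 0, 0, 0, 0, 0, 0, 0, 0, 0], fun c => x.getD c 0) 18 := by
  have hB' : 2 ^ 7 ≤ 2 ^ B := Nat.pow_le_pow_right (by decide) hB
  have hx0 : x[0]?.getD 0 = n := by rw [hx]; rfl
  have hx1 : x[1]?.getD 0 = m := by rw [hx]; rfl
  refine Runs.block ?_ ?_ ?_
  · simp [preamble, Prog.Fits, Prog.eval, Prog.seqs, inputConfig, List.replicate_succ,
      ArithOp.eval, hx0]
    omega
  · simp [preamble, Prog.eval, Prog.seqs, inputConfig, List.replicate_succ, ArithOp.eval, hx0, hx1]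
  · simp [preamble, Prog.steps, Prog.seqs]

theorem runs_doubleLoop {B len m : ℕ} (f : ℕ → ℕ) (h : ℕ) : ∀ Q, Q * 2 ^ h < 2 ^ B →
    Runs B doubleLoop
      ([len, 1, 2, 3, 4, 5, 6, 7, 8, 9, 10, 11, 12, 0, m, 0, 0, 0, 0, 0, 0, Q, h,
        0, 0, 0, 0, 0, 0, 0, 0, 0, 0, 0, 0], f)
      ([len, 1, 2, 3, 4, 5, 6, 7, 8, 9, 10, 11, 12, 0, m, 0, 0, 0, 0, 0, 0, Q * 2 ^ h, 0,
        0, 0, 0, 0, 0, 0, 0, 0, 0, 0, 0, 0], f) (3 * h + 1) := by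
  induction h with
  | zero => intro Q _; rw [pow_zero, mul_one]; exact Runs.loop_false (by simp)
  | succ h ih =>
    intro Q hQ
    have e : (Q + Q) * 2 ^ h = Q * 2 ^ (h + 1) := by ring
    have h1 := ih (Q + Q) (by rwa [e])
    rw [e] at h1
    have : (Q + Q) * 1 ≤ (Q + Q) * 2 ^ h := Nat.mul_le_mul_left _ Nat.one_le_two_pow
    refine (Runs.loop_true (k₁ := 2) (by simp) (Runs.block ?_ rfl ?_) h1).mono (by omega)
    · simp [Prog.Fits, Prog.eval]; omega
    · simp [Prog.steps]

theorem length_graphOut (n : ℕ) (cs : List (List ℕ)) :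
    (graphOut n cs).length = numPartial n * (cs.length + 2) * 20 * 3 + 3 := by
  simp only [graphOut, List.length_cons, List.length_flatMap, length_row, List.map_const',
    List.length_range, List.sum_replicate, smul_eq_mul]
  ring

theorem runs_cleanup {B : ℕ} (a : Params) (ha : a.total < 2 ^ B) (out p pv : ℕ) (f : ℕ → ℕ) :
    Runs B cleanup (layout a out 0 p pv 0 0 0 0 0 0 0 0 0 0 0, f)
      (a.total :: List.replicate 34 0, f) 23 := by
  refine Runs.block ?_ ?_ (by simp [cleanup, Prog.steps, Prog.seqs])
  · simpa [cleanup, Prog.Fits, Prog.eval, Prog.seqs, layout] using ha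
  · simp [cleanup, Prog.eval, Prog.seqs, layout, ArithOp.eval, List.replicate_succ]

theorem runs_computeSizes {B len m K Q : ℕ} (f : ℕ → ℕ) (hK : K = m + 2) (hm : K + 1 < 2 ^ B)
    (hQ : Q * (K + 1) + K + 1 < 2 ^ B) (hlen : Q * K * 20 * 3 + 3 + len + 20 < 2 ^ B) :
    Runs B computeSizes
      ([len, 1, 2, 3, 4, 5, 6, 7, 8, 9, 10, 11, 12, 0, m, 0, 0, 0, 0, 0, 0,
        Q, 0, 0, 0, 0, 0, 0, 0, 0, 0, 0, 0, 0, 0], f)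
      (layout (sizeParams len m K Q) 0 Q 0 (Q * K * 20) (Q * (K + 1) + K + 1) len
        0 0 0 0 0 0 0 0 0, f) 13 := by
  refine Runs.block ?_ ?_ ?_
  · simp [computeSizes, Prog.Fits, Prog.eval, Prog.seqs, ArithOp.eval, ← hK]
    omega
  · simp [computeSizes, Prog.eval, Prog.seqs, layout, sizeParams, ArithOp.eval, ← hK]
  · simp [computeSizes, Prog.steps, Prog.seqs]

theorem runs_reduction {B W k n : ℕ} {cs : List (List ℕ)} {x : List ℕ}
    (hxin : x = n :: cs.length :: cs.flatMap encodeClause)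
    (hB : 7 ≤ B) (hD : (graphOut n cs).length + x.length + x.length + 20 < 2 ^ B)
    (hx : ∀ v ∈ x, v + 1 < 2 ^ B) (hW : ∀ c ∈ cs, c.length ≤ k ∧ ∀ l ∈ c, l ≤ 4 * W) :
    Runs B reduction (inputConfig x) (inputConfig (graphOut n cs))
      (3 * n + 15 * x.length +
        numPartial n * (cs.length * (k * (3 * W + 31) + 140) + 301) + 110) := by
  have hB' : 2 ^ 7 ≤ 2 ^ B := Nat.pow_le_pow_right (by decide) hB
  have hlen := length_graphOut n cs
  set Q := numPartial n with hQ
  set K := cs.length + 2 with hK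
  have hQ2 : 2 * 2 ^ ((n + 1) / 2) = Q := rfl
  have hQ1 : 1 ≤ Q := by have := Nat.one_le_two_pow (n := (n + 1) / 2); omega
  have hQK : Q ≤ Q * K := Nat.le_mul_of_pos_right _ (by omega)
  have hQK' : K ≤ Q * K := Nat.le_mul_of_pos_left _ (by omega)
  have hQK1 : Q * (K + 1) = Q * K + Q := by ring
  set o₀ : List ℕ := [Q * (K + 1) + K + 1, 12, Q * K * 20] with ho₀
  have hxn : n + 1 < 2 ^ B := hx n (by simp [hxin])
  let a : Params := sizeParams x.length cs.length K Q
  have hout : graphOut n cs = o₀ ++ (List.range Q).flatMap (row a.K a.hub cs) := rfl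
  have h1 : Runs B preamble (inputConfig x) _ 18 := runs_preamble hB hxin hxn
  have h2 := runs_doubleLoop (B := B) (len := x.length) (m := cs.length) (fun c => x.getD c 0)
    ((n + 1) / 2) 2 (by omega)
  rw [hQ2] at h2
  have h3 : Runs B computeSizes _ (layout a 0 Q 0 _ _ x.length 0 0 0 0 0 0 0 0 0, _) 13 :=
    runs_computeSizes (fun c => x.getD c 0) hK (by omega) (by omega) (by omega)
  have h4 := runs_moveLoop (B := B) a x 0 Q 0 (Q * K * 20) (Q * (K + 1) + K + 1) x.length
    (by simp only [a, sizeParams]; omega) (by simp only [a, sizeParams]; omega)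
  rw [halfMoved_zero, halfMoved_length] at h4
  have h5 := runs_pushAll (B := B) (D := a.D) (x := x) (by simp only [a, sizeParams]; omega) [24, 12, 23]
    (layout a 0 Q 0 (Q * K * 20) (Q * (K + 1) + K + 1) 0 0 0 0 0 0 0 0 0 0) [] rfl rfl
    (by simp [layout]) (by decide) (by simp [a, sizeParams]; omega)
  have h6 : Runs B (.seqs [.const 24 0, .arith .add 23 15 13])
      (layout a 3 Q 0 (Q * K * 20) (Q * (K + 1) + K + 1) 0 0 0 0 0 0 0 0 0 0, twoLists o₀ a.D x)
      (layout a 3 Q 0 (0 * (a.K + 1) + a.K) 0 0 0 0 0 0 0 0 0 0 0, twoLists o₀ a.D x) 3 := by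
    rw [zero_mul, zero_add]
    refine Runs.block ?_ rfl ?_
    · simp [Prog.Fits, Prog.eval, Prog.seqs, layout, a, sizeParams]; omega
    · simp [Prog.steps, Prog.seqs]
  have h7 := runs_rowLoop (a := a) (B := B) hB (by simp only [a, sizeParams]; omega)
    (fun v hv => (Nat.lt_succ_self v).trans (hx v hv)) hW hxin rfl rfl
    (by simp only [a, sizeParams]; omega) (by simp only [a, sizeParams]; omega) Q 0 o₀
    (by simp only [a, sizeParams, zero_add]; omega) (by
      have : 60 * K * Q = Q * K * 20 * 3 := by ring
      simp only [a, sizeParams, ho₀, List.length_cons, List.length_nil]; omega)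
  rw [← List.range_eq_range', zero_add, ← hout] at h7
  have h8 := runs_clearLoop (B := B) a x (graphOut n cs) (by simp only [a, sizeParams]; omega)
    (3 + 60 * K * Q) 0 Q (Q * (a.K + 1) + a.K) x.length (by simp only [a, sizeParams]; omega)
  rw [List.take_length] at h8
  have h9 := runs_cleanup (B := B) { a with len := 0 } (by simp only [a, sizeParams]; omega)
    (3 + 60 * K * Q) Q (Q * (a.K + 1) + a.K) fun c => (graphOut n cs).getD c 0
  have he : inputConfig (graphOut n cs) =
      (a.total :: List.replicate 34 0, fun c => (graphOut n cs).getD c 0) := by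
    simp only [inputConfig, hlen, a, sizeParams]
  rw [he]
  refine (h1.seq (h2.seq (h3.seq (h4.seq (h5.seq (h6.seq (h7.seq (h8.seq h9)))))))).mono ?_
  simp only [List.length_cons, List.length_nil]; omega

/-! ### Temporal graphs given by a listing -/

section Listing

variable {n : ℕ}

/-- The temporal graph whose temporal edges are listed. -/
def graphOfListing (τ : ℕ) (l : List (Fin n × Fin n × ℕ))
    (hτ : ∀ e ∈ l, e.2.2 ∈ Finset.Icc 1 τ) (hl : ∀ e ∈ l, e.1 ≠ e.2.1) : TemporalGraph n where
  lifetime := τ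
  lam u v := ((l.filter fun e => e.1 = u ∧ e.2.1 = v).map fun e => e.2.2).toFinset
  lam_subset u v t ht := by
    simp only [List.mem_toFinset, List.mem_map, List.mem_filter] at ht
    obtain ⟨e, ⟨he, _⟩, rfl⟩ := ht
    exact hτ e he
  loopless u := by
    ext t
    simp only [List.mem_toFinset, List.mem_map, List.mem_filter, decide_eq_true_eq,
      Finset.notMem_empty, iff_false]
    rintro ⟨e, ⟨he, h1, h2⟩, _⟩
    exact hl e he (h1.trans h2.symm)

theorem mem_lam_graphOfListing {τ : ℕ} {l : List (Fin n × Fin n × ℕ)}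
    {hτ : ∀ e ∈ l, e.2.2 ∈ Finset.Icc 1 τ} {hl : ∀ e ∈ l, e.1 ≠ e.2.1} {u v : Fin n} {t : ℕ} :
    t ∈ (graphOfListing τ l hτ hl).lam u v ↔ (u, v, t) ∈ l := by
  simp only [graphOfListing, List.mem_toFinset, List.mem_map, List.mem_filter, decide_eq_true_eq]
  constructor
  · rintro ⟨⟨_, _, _⟩, ⟨he, rfl, rfl⟩, rfl⟩
    exact he
  · exact fun h => ⟨_, ⟨h, rfl, rfl⟩, rfl⟩

theorem numTemporalEdges_le_length {G : TemporalGraph n} {l : List (Fin n × Fin n × ℕ)}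
    (h : G.IsListing l) (κ : Kind) : G.numTemporalEdges κ ≤ l.length := by
  have hdir : ∑ u, ∑ v, (G.lam u v).card ≤ l.length := by
    rw [← Fintype.sum_prod_type' fun u v => (G.lam u v).card, ← Finset.card_sigma]
    refine (Finset.card_le_card_of_injOn (t := l.toFinset)
      (fun x => (x.1.1, x.1.2, x.2)) ?_ ?_).trans (List.toFinset_card_le l)
    · intro x hx
      simp only [Finset.coe_sigma, Set.mem_sigma_iff, Finset.mem_coe] at hx
      simpa [h.2] using hx.2
    · rintro ⟨⟨u, v⟩, t⟩ _ ⟨⟨u', v'⟩, t'⟩ _ he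
      simp_all
  cases κ with
  | directed => exact hdir
  | undirected =>
    exact (Finset.sum_le_sum fun u _ => Finset.sum_le_sum_of_subset (Finset.subset_univ _)).trans
      hdir

theorem isWalk_append {G : TemporalGraph n} {v w : Fin n} (l₁ l₂ : List (ℕ × Fin n)) :
    ∀ {u}, G.IsWalk u l₁ v → G.IsWalk v l₂ w → G.IsWalk u (l₁ ++ l₂) w := by
  induction l₁ with
  | nil => intro u h1 h2; cases h1; exact h2
  | cons e l ih => intro u h1 h2; exact ⟨h1.1, ih h1.2 h2⟩

/-- There is a walk from `u` to `v` with increasing times between `a` and `b`. -/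
def WalkWithin (G : TemporalGraph n) (a b : ℕ) (u v : Fin n) : Prop :=
  ∃ l : List (ℕ × Fin n), G.IsWalk u l v ∧ (l.map Prod.fst).Pairwise (· < ·) ∧
    ∀ t ∈ l.map Prod.fst, a ≤ t ∧ t ≤ b

theorem WalkWithin.reaches {G : TemporalGraph n} {a b : ℕ} {u v : Fin n}
    (h : WalkWithin G a b u v) (m : Model) : G.Reaches m u v := by
  obtain ⟨l, h1, h2, -⟩ := h
  refine ⟨l, h1, h2.imp ?_⟩
  cases m
  exacts [id, le_of_lt]

theorem WalkWithin.trans {G : TemporalGraph n} {a b c d : ℕ} {u v w : Fin n}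
    (h₁ : WalkWithin G a b u v) (h₂ : WalkWithin G c d v w) (hbc : b < c) (hab : a ≤ b)
    (hcd : c ≤ d) :
    WalkWithin G a d u w := by
  obtain ⟨l₁, h1, h2, h3⟩ := h₁
  obtain ⟨l₂, h4, h5, h6⟩ := h₂
  refine ⟨l₁ ++ l₂, isWalk_append _ _ h1 h4, ?_, ?_⟩
  · rw [List.map_append, List.pairwise_append]
    exact ⟨h2, h5, fun s hs t ht => ((h3 s hs).2.trans_lt hbc).trans_le (h6 t ht).1⟩
  · intro t ht
    rw [List.map_append, List.mem_append] at ht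
    rcases ht with ht | ht
    · have := h3 t ht; omega
    · have := h6 t ht; omega

theorem WalkWithin.mono {G : TemporalGraph n} {a b a' b' : ℕ} {u v : Fin n}
    (h : WalkWithin G a b u v) (ha : a' ≤ a) (hb : b ≤ b') : WalkWithin G a' b' u v :=
  let ⟨l, h1, h2, h3⟩ := h
  ⟨l, h1, h2, fun t ht => ⟨ha.trans (h3 t ht).1, (h3 t ht).2.trans hb⟩⟩

theorem WalkWithin.refl {G : TemporalGraph n} {a b : ℕ} (u : Fin n) : WalkWithin G a b u u :=
  ⟨[], rfl, by simp, by simp⟩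

theorem WalkWithin.edge {G : TemporalGraph n} {a b t : ℕ} {u v : Fin n} (h : t ∈ G.lam u v)
    (ha : a ≤ t) (hb : t ≤ b) : WalkWithin G a b u v :=
  ⟨[(t, v)], ⟨h, rfl⟩, by simp, by simp [ha, hb]⟩

/-- A property of a vertex and a time that holds at the start, and that edges preserve, holds at
the end of every temporal walk. -/
theorem reaches_invariant {G : TemporalGraph n} {m : Model} {I : ℕ → Fin n → Prop}
    (hI : ∀ s t u v, s ≤ t → t ∈ G.lam u v → I s u → I t v) {u v : Fin n} (h0 : I 0 u)
    (h : G.Reaches m u v) : ∃ t, I t v := by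
  obtain ⟨l, hw, hp⟩ := h
  have hp' : (0 :: l.map Prod.fst).Pairwise (· ≤ ·) :=
    List.pairwise_cons.2 ⟨fun _ _ => Nat.zero_le _, hp.imp fun h => by
      cases m
      exacts [le_of_lt h, h]⟩
  clear hp
  generalize 0 = s at h0 hp'
  induction l generalizing u s with
  | nil => cases hw; exact ⟨s, h0⟩
  | cons e l ih =>
    obtain ⟨t, w⟩ := e
    rw [List.map_cons, List.pairwise_cons] at hp'
    exact ih hw.2 t (hI s t u w (hp'.1 t (by simp)) hw.1 h0) hp'.2

end Listing

/-! ### The graph -/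

section Grid

variable {Q K : ℕ}

/-- The vertices form a grid. The last column holds the vertices of the rows, the last row holds
the vertices of the columns, the corner is the hub, and the other vertices are the leaves. -/
def gridVertex (q : Fin (Q + 1)) (j : Fin (K + 1)) : Fin ((Q + 1) * (K + 1)) :=
  finProdFinEquiv (q, j)

/-- The vertex of row `p`, which stands for a partial assignment. -/
def rowVertex (K : ℕ) (p : Fin Q) : Fin ((Q + 1) * (K + 1)) := gridVertex p.castSucc (Fin.last K)

/-- The vertex of column `j`, which stands for a clause. -/
def colVertex (Q : ℕ) (j : Fin K) : Fin ((Q + 1) * (K + 1)) := gridVertex (Fin.last Q) j.castSucc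

/-- The hub is adjacent to all leaves, and connects all pairs of vertices other than pairs of rows. -/
def hubVertex (Q K : ℕ) : Fin ((Q + 1) * (K + 1)) := gridVertex (Fin.last Q) (Fin.last K)

/-- The leaf of row `p` and column `j`. It keeps walks from going on to a further row too early:
with a direct edge between a row and a column, a nonstrict walk could pass through several rows at
one time. -/
def leafVertex (p : Fin Q) (j : Fin K) : Fin ((Q + 1) * (K + 1)) :=
  gridVertex p.castSucc j.castSucc

theorem gridVertex_inj {q q' : Fin (Q + 1)} {j j' : Fin (K + 1)} :
    gridVertex q j = gridVertex q' j' ↔ q = q' ∧ j = j' := by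
  simp [gridVertex]

theorem last_ne_castSucc {n : ℕ} (i : Fin n) : Fin.last n ≠ i.castSucc :=
  (Fin.castSucc_ne_last i).symm

@[simp] theorem rowVertex_inj {p p' : Fin Q} : rowVertex K p = rowVertex K p' ↔ p = p' := by
  simp [rowVertex, gridVertex_inj]
@[simp] theorem colVertex_inj {j j' : Fin K} : colVertex Q j = colVertex Q j' ↔ j = j' := by
  simp [colVertex, gridVertex_inj]
@[simp] theorem leafVertex_inj {p p' : Fin Q} {j j' : Fin K} :
    leafVertex p j = leafVertex p' j' ↔ p = p' ∧ j = j' := by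
  simp [leafVertex, gridVertex_inj]
@[simp] theorem rowVertex_ne_leaf (p p' : Fin Q) (j : Fin K) : rowVertex K p ≠ leafVertex p' j := by
  simp [rowVertex, leafVertex, gridVertex_inj, last_ne_castSucc]
@[simp] theorem colVertex_ne_leaf (p : Fin Q) (j j' : Fin K) : colVertex Q j' ≠ leafVertex p j := by
  simp [colVertex, leafVertex, gridVertex_inj, last_ne_castSucc]
@[simp] theorem hubVertex_ne_leaf (p : Fin Q) (j : Fin K) : hubVertex Q K ≠ leafVertex p j := by
  simp [hubVertex, leafVertex, gridVertex_inj, last_ne_castSucc]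
@[simp] theorem rowVertex_ne_col (p : Fin Q) (j : Fin K) : rowVertex K p ≠ colVertex Q j := by
  simp [rowVertex, colVertex, gridVertex_inj, Fin.castSucc_ne_last]
@[simp] theorem rowVertex_ne_hub (p : Fin Q) : rowVertex K p ≠ hubVertex Q K := by
  simp [rowVertex, hubVertex, gridVertex_inj, Fin.castSucc_ne_last]
@[simp] theorem colVertex_ne_hub (j : Fin K) : colVertex Q j ≠ hubVertex Q K := by
  simp [colVertex, hubVertex, gridVertex_inj, Fin.castSucc_ne_last]

theorem vertex_cases {motive : Fin ((Q + 1) * (K + 1)) → Prop} (hrow : ∀ p, motive (rowVertex K p))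
    (hcol : ∀ j, motive (colVertex Q j)) (hhub : motive (hubVertex Q K))
    (hleaf : ∀ p j, motive (leafVertex p j)) (v : Fin ((Q + 1) * (K + 1))) : motive v := by
  obtain ⟨⟨q, j⟩, rfl⟩ := (finProdFinEquiv (m := Q + 1) (n := K + 1)).surjective v
  refine Fin.lastCases ?_ (fun p => ?_) q <;> refine Fin.lastCases ?_ (fun j => ?_) j
  exacts [hhub, hcol j, hrow p, hleaf p j]

/-- The neighbours of a leaf with the times at which the edges are available. The only times that
depend on `F p j` are those in the middle at the edge to the column: `7, 8` if it is true, and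
`2, 3` otherwise. -/
def leafIncidences (F : Fin Q → Fin K → Bool) (p : Fin Q) (j : Fin K) :
    List (Fin ((Q + 1) * (K + 1)) × ℕ) :=
  let x := if F p j then 7 else 2
  [(rowVertex K p, 6), (rowVertex K p, 9), (colVertex Q j, 1), (colVertex Q j, x),
    (colVertex Q j, x + 1), (colVertex Q j, 12), (hubVertex Q K, 4), (hubVertex Q K, 5),
    (hubVertex Q K, 10), (hubVertex Q K, 11)]

/-- The temporal edges at a leaf, in both directions. -/
def leafEdges (F : Fin Q → Fin K → Bool) (pj : Fin Q × Fin K) :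
    List (Fin ((Q + 1) * (K + 1)) × Fin ((Q + 1) * (K + 1)) × ℕ) :=
  (leafIncidences F pj.1 pj.2).flatMap fun e =>
    [(leafVertex pj.1 pj.2, e.1, e.2), (e.1, leafVertex pj.1 pj.2, e.2)]

/-- A listing of the temporal edges of the graph. -/
def gridListing (F : Fin Q → Fin K → Bool) :
    List (Fin ((Q + 1) * (K + 1)) × Fin ((Q + 1) * (K + 1)) × ℕ) :=
  (List.finRange Q ×ˢ List.finRange K).flatMap (leafEdges F)

variable {F : Fin Q → Fin K → Bool}

theorem ne_leaf_of_mem {p p' : Fin Q} {j j' : Fin K} {e : Fin ((Q + 1) * (K + 1)) × ℕ}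
    (he : e ∈ leafIncidences F p j) : e.1 ≠ leafVertex p' j' := by
  simp only [leafIncidences, List.mem_cons, List.not_mem_nil, or_false] at he
  rcases he with rfl | rfl | rfl | rfl | rfl | rfl | rfl | rfl | rfl | rfl <;> simp

theorem time_of_mem {p : Fin Q} {j : Fin K} {e : Fin ((Q + 1) * (K + 1)) × ℕ}
    (he : e ∈ leafIncidences F p j) : e.2 ∈ Finset.Icc 1 12 := by
  simp only [leafIncidences, List.mem_cons, List.not_mem_nil, or_false] at he
  rcases he with rfl | rfl | rfl | rfl | rfl | rfl | rfl | rfl | rfl | rfl <;>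
    cases F p j <;> simp

theorem mem_leafEdges {pj : Fin Q × Fin K} {u v : Fin ((Q + 1) * (K + 1))} {t : ℕ} :
    (u, v, t) ∈ leafEdges F pj ↔ ∃ w, (w, t) ∈ leafIncidences F pj.1 pj.2 ∧
      (u = leafVertex pj.1 pj.2 ∧ v = w ∨ u = w ∧ v = leafVertex pj.1 pj.2) := by
  simp only [leafEdges, List.mem_flatMap, List.mem_cons, Prod.mk.injEq, List.not_mem_nil, or_false]
  constructor
  · rintro ⟨⟨w, s⟩, h, ⟨rfl, rfl, rfl⟩ | ⟨rfl, rfl, rfl⟩⟩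
    exacts [⟨_, h, .inl ⟨rfl, rfl⟩⟩, ⟨_, h, .inr ⟨rfl, rfl⟩⟩]
  · rintro ⟨w, h, ⟨rfl, rfl⟩ | ⟨rfl, rfl⟩⟩
    exacts [⟨_, h, .inl ⟨rfl, rfl, rfl⟩⟩, ⟨_, h, .inr ⟨rfl, rfl, rfl⟩⟩]

theorem mem_gridListing {u v : Fin ((Q + 1) * (K + 1))} {t : ℕ} :
    (u, v, t) ∈ gridListing F ↔ ∃ p j w, (w, t) ∈ leafIncidences F p j ∧
      (u = leafVertex p j ∧ v = w ∨ u = w ∧ v = leafVertex p j) := by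
  have (p : Fin Q) (j : Fin K) : (p, j) ∈ List.finRange Q ×ˢ List.finRange K :=
    List.pair_mem_product.2 ⟨List.mem_finRange p, List.mem_finRange j⟩
  simp only [gridListing, List.mem_flatMap, mem_leafEdges, Prod.exists, this, true_and]

theorem nodup_leafEdges (pj : Fin Q × Fin K) : (leafEdges F pj).Nodup := by
  rw [leafEdges, List.nodup_flatMap]
  constructor
  · intro e he
    have := ne_leaf_of_mem (p' := pj.1) (j' := pj.2) he
    simp [this.symm]
  · -- the ten times at a leaf are distinct
    have h : ((leafIncidences F pj.1 pj.2).map Prod.snd).Nodup := by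
      cases h : F pj.1 pj.2 <;> simp [leafIncidences, h]
    rw [List.Nodup, List.pairwise_map] at h
    refine h.imp fun {e e'} hne => ?_
    rintro ⟨u, v, t⟩ h1 h2
    simp only [List.mem_cons, Prod.mk.injEq, List.not_mem_nil, or_false] at h1 h2
    exact hne (by rcases h1 with h1 | h1 <;> rcases h2 with h2 | h2 <;> rw [← h1.2.2, ← h2.2.2])

theorem nodup_gridListing : (gridListing F).Nodup := by
  rw [gridListing, List.nodup_flatMap]
  refine ⟨fun pj _ => nodup_leafEdges pj, ?_⟩
  refine ((List.nodup_finRange Q).product (List.nodup_finRange K)).pairwise_of_forall_ne ?_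
  rintro ⟨p, j⟩ _ ⟨p', j'⟩ _ hne ⟨u, v, t⟩ h1 h2
  rw [mem_leafEdges] at h1 h2
  obtain ⟨w, h1, h1'⟩ := h1
  obtain ⟨w', h2, h2'⟩ := h2
  have hw := ne_leaf_of_mem (p' := p') (j' := j') h1
  have hw' := ne_leaf_of_mem (p' := p) (j' := j) h2
  have hl : leafVertex p j ≠ leafVertex p' j' := by simpa using hne
  rcases h1' with ⟨rfl, rfl⟩ | ⟨rfl, rfl⟩ <;> rcases h2' with ⟨h, h'⟩ | ⟨h, h'⟩ <;> simp_all

/-- The temporal graph with this listing. -/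
def gridGraph (F : Fin Q → Fin K → Bool) : TemporalGraph ((Q + 1) * (K + 1)) :=
  graphOfListing 12 (gridListing F)
    (fun ⟨u, v, t⟩ he => by
      obtain ⟨p, j, w, h, _⟩ := mem_gridListing.1 he
      exact (time_of_mem h :))
    (fun ⟨u, v, t⟩ he => by
      obtain ⟨p, j, w, h, ⟨rfl, rfl⟩ | ⟨rfl, rfl⟩⟩ := mem_gridListing.1 he
      · exact (ne_leaf_of_mem h).symm
      · exact ne_leaf_of_mem h)

theorem mem_lam {u v : Fin ((Q + 1) * (K + 1))} {t : ℕ} :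
    t ∈ (gridGraph F).lam u v ↔ ∃ p j w, (w, t) ∈ leafIncidences F p j ∧
      (u = leafVertex p j ∧ v = w ∨ u = w ∧ v = leafVertex p j) :=
  mem_lam_graphOfListing.trans mem_gridListing

theorem isListing_gridListing : (gridGraph F).IsListing (gridListing F) :=
  ⟨nodup_gridListing, fun _ _ _ => mem_lam_graphOfListing.symm⟩

theorem lam_symm (u v : Fin ((Q + 1) * (K + 1))) :
    (gridGraph F).lam u v = (gridGraph F).lam v u := by
  ext t
  simp only [mem_lam]
  refine exists_congr fun p => exists_congr fun j => exists_congr fun w => and_congr_right fun _ => ?_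
  tauto

theorem isOfKind_gridGraph (κ : Kind) : (gridGraph F).IsOfKind κ := by
  cases κ
  exacts [trivial, lam_symm]

theorem mem_lam_leaf {p : Fin Q} {j : Fin K} {w : Fin ((Q + 1) * (K + 1))} {t : ℕ}
    (h : (w, t) ∈ leafIncidences F p j) : t ∈ (gridGraph F).lam (leafVertex p j) w :=
  mem_lam.2 ⟨p, j, w, h, .inl ⟨rfl, rfl⟩⟩

theorem mem_lam_leaf' {p : Fin Q} {j : Fin K} {w : Fin ((Q + 1) * (K + 1))} {t : ℕ}
    (h : (w, t) ∈ leafIncidences F p j) : t ∈ (gridGraph F).lam w (leafVertex p j) :=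
  mem_lam.2 ⟨p, j, w, h, .inr ⟨rfl, rfl⟩⟩

theorem noIsolated_gridGraph (p₀ : Fin Q) (j₀ : Fin K) : (gridGraph F).NoIsolated := by
  refine vertex_cases (fun p => ?_) (fun j => ?_) ?_ (fun p j => ?_)
  · exact ⟨leafVertex p j₀, .inl ⟨6, mem_lam_leaf' (by simp [leafIncidences])⟩⟩
  · exact ⟨leafVertex p₀ j, .inl ⟨1, mem_lam_leaf' (by simp [leafIncidences])⟩⟩
  · exact ⟨leafVertex p₀ j₀, .inl ⟨4, mem_lam_leaf' (by simp [leafIncidences])⟩⟩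
  · exact ⟨hubVertex Q K, .inl ⟨4, mem_lam_leaf (by simp [leafIncidences])⟩⟩

/-! ### Reachability in the graph -/

/-- What a walk that started in the vertex of row `a` can have reached until time `t`: it spends the
times `6` to `9` on going from row `a` to a column `j` with `F a j`, and on to rows `p` with
`F p j`; from time `10` on no edge leads to the vertex of a row. -/
def ReachedBy (F : Fin Q → Fin K → Bool) (a : Fin Q) (t : ℕ) (v : Fin ((Q + 1) * (K + 1))) : Prop :=
  (∀ p, v = rowVertex K p → p = a ∨ 9 ≤ t ∧ ∃ j, F a j ∧ F p j) ∧
  (∀ p j, v = leafVertex p j → 10 ≤ t ∨ 6 ≤ t ∧ p = a ∨ 7 ≤ t ∧ F a j ∧ F p j ∨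
    9 ≤ t ∧ ∃ i, F a i ∧ F p i) ∧
  (∀ j, v = colVertex Q j → 10 ≤ t ∨ 7 ≤ t ∧ F a j) ∧
  (v = hubVertex Q K → 10 ≤ t)

theorem reachedBy_row {a p : Fin Q} {t : ℕ} :
    ReachedBy F a t (rowVertex K p) ↔ p = a ∨ 9 ≤ t ∧ ∃ j, F a j ∧ F p j := by
  simp [ReachedBy]

theorem reachedBy_leaf {a p : Fin Q} {j : Fin K} {t : ℕ} :
    ReachedBy F a t (leafVertex p j) ↔ 10 ≤ t ∨ 6 ≤ t ∧ p = a ∨ 7 ≤ t ∧ F a j ∧ F p j ∨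
      9 ≤ t ∧ ∃ i, F a i ∧ F p i := by
  simp [ReachedBy, (rowVertex_ne_leaf _ _ _).symm, (colVertex_ne_leaf _ _ _).symm,
    (hubVertex_ne_leaf _ _).symm]

theorem reachedBy_col {a : Fin Q} {j : Fin K} {t : ℕ} :
    ReachedBy F a t (colVertex Q j) ↔ 10 ≤ t ∨ 7 ≤ t ∧ F a j := by
  simp [ReachedBy, (rowVertex_ne_col _ _).symm]

theorem reachedBy_hub {a : Fin Q} {t : ℕ} :
    ReachedBy F a t (hubVertex Q K) ↔ 10 ≤ t := by
  simp [ReachedBy, (rowVertex_ne_hub _).symm, (colVertex_ne_hub _).symm]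

theorem reachedBy_step {a : Fin Q} (s t : ℕ) (u v : Fin ((Q + 1) * (K + 1))) (hst : s ≤ t)
    (h : t ∈ (gridGraph F).lam u v) (hs : ReachedBy F a s u) : ReachedBy F a t v := by
  obtain ⟨p, j, w, hw, h⟩ := mem_lam.1 h
  simp only [leafIncidences, List.mem_cons, List.not_mem_nil, or_false, Prod.mk.injEq] at hw
  rcases h with ⟨rfl, rfl⟩ | ⟨rfl, rfl⟩
  all_goals
    rcases hw with ⟨rfl, rfl⟩ | ⟨rfl, rfl⟩ | ⟨rfl, rfl⟩ | ⟨rfl, rfl⟩ | ⟨rfl, rfl⟩ | ⟨rfl, rfl⟩ |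
      ⟨rfl, rfl⟩ | ⟨rfl, rfl⟩ | ⟨rfl, rfl⟩ | ⟨rfl, rfl⟩
    -- one case for each of the ten temporal edges at a leaf, in both directions
    all_goals
      rw [reachedBy_leaf] at *
      simp only [reachedBy_row, reachedBy_col, reachedBy_hub] at *
      grind

theorem not_reaches_row {a b : Fin Q} (hab : a ≠ b) (h : ∀ j, ¬ (F a j ∧ F b j)) (m : Model) :
    ¬ (gridGraph F).Reaches m (rowVertex K a) (rowVertex K b) := by
  intro hr
  obtain ⟨t, ht⟩ := reaches_invariant (I := ReachedBy F a) reachedBy_step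
    (reachedBy_row.2 (.inl rfl)) hr
  rcases reachedBy_row.1 ht with rfl | ⟨-, j, hj⟩
  exacts [hab rfl, h j hj]

/-- The early times at the hub serve walks that do not start in the vertex of a row. -/
theorem walk_to_hub (p₀ : Fin Q) (v : Fin ((Q + 1) * (K + 1))) (hv : ∀ p, v ≠ rowVertex K p) :
    WalkWithin (gridGraph F) 1 4 v (hubVertex Q K) := by
  have hleaf : ∀ p j, WalkWithin (gridGraph F) 2 4 (leafVertex p j) (hubVertex Q K) := fun p j =>
    .edge (t := 4) (mem_lam_leaf (by simp [leafIncidences])) (by decide) (by decide)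
  induction v using vertex_cases with
  | hrow p => exact absurd rfl (hv p)
  | hcol j =>
    exact WalkWithin.trans (b := 1) (c := 2) (.edge (t := 1)
      (mem_lam_leaf' (p := p₀) (by simp [leafIncidences])) le_rfl le_rfl) (hleaf p₀ j)
      (by decide) le_rfl (by decide)
  | hhub => exact .refl _
  | hleaf p j => exact (hleaf p j).mono (by decide) le_rfl

/-- The late times at the hub serve walks that do not end in the vertex of a row. -/
theorem walk_from_hub (p₀ : Fin Q) (v : Fin ((Q + 1) * (K + 1))) (hv : ∀ p, v ≠ rowVertex K p) :
    WalkWithin (gridGraph F) 11 12 (hubVertex Q K) v := by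
  have hleaf : ∀ p j, WalkWithin (gridGraph F) 11 11 (hubVertex Q K) (leafVertex p j) := fun p j =>
    .edge (t := 11) (mem_lam_leaf' (by simp [leafIncidences])) le_rfl le_rfl
  induction v using vertex_cases with
  | hrow p => exact absurd rfl (hv p)
  | hcol j =>
    exact (hleaf p₀ j).trans (c := 12) (d := 12) (.edge (t := 12)
      (mem_lam_leaf (by simp [leafIncidences])) le_rfl le_rfl) (by decide) le_rfl le_rfl
  | hhub => exact .refl _
  | hleaf p j => exact (hleaf p j).mono le_rfl (by decide)

theorem walk_hub_row (j₀ : Fin K) (p : Fin Q) :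
    WalkWithin (gridGraph F) 5 6 (hubVertex Q K) (rowVertex K p) :=
  WalkWithin.trans (v := leafVertex p j₀) (b := 5) (c := 6)
    (.edge (t := 5) (mem_lam_leaf' (by simp [leafIncidences])) le_rfl le_rfl)
    (.edge (t := 6) (mem_lam_leaf (by simp [leafIncidences])) le_rfl le_rfl)
    (by decide) le_rfl le_rfl

theorem walk_row_hub (j₀ : Fin K) (p : Fin Q) :
    WalkWithin (gridGraph F) 6 10 (rowVertex K p) (hubVertex Q K) :=
  WalkWithin.trans (v := leafVertex p j₀) (b := 6) (c := 10)
    (.edge (t := 6) (mem_lam_leaf' (by simp [leafIncidences])) le_rfl le_rfl)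
    (.edge (t := 10) (mem_lam_leaf (by simp [leafIncidences])) le_rfl le_rfl)
    (by decide) le_rfl le_rfl

theorem walk_row_row {p p' : Fin Q} {j : Fin K} (h : F p j) (h' : F p' j) :
    WalkWithin (gridGraph F) 6 9 (rowVertex K p) (rowVertex K p') := by
  have h1 : WalkWithin (gridGraph F) 6 7 (rowVertex K p) (colVertex Q j) :=
    WalkWithin.trans (v := leafVertex p j) (b := 6) (c := 7)
      (.edge (t := 6) (mem_lam_leaf' (by simp [leafIncidences])) le_rfl le_rfl)
      (.edge (t := 7) (mem_lam_leaf (by simp [leafIncidences, h])) le_rfl le_rfl)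
      (by decide) le_rfl le_rfl
  have h2 : WalkWithin (gridGraph F) 8 9 (colVertex Q j) (rowVertex K p') :=
    WalkWithin.trans (v := leafVertex p' j) (b := 8) (c := 9)
      (.edge (t := 8) (mem_lam_leaf' (by simp [leafIncidences, h'])) le_rfl le_rfl)
      (.edge (t := 9) (mem_lam_leaf (by simp [leafIncidences])) le_rfl le_rfl)
      (by decide) le_rfl le_rfl
  exact h1.trans h2 (by decide) (by decide) (by decide)

theorem temporallyConnected_gridGraph (p₀ : Fin Q) (j₀ : Fin K)
    (h : ∀ p p', ∃ j, F p j ∧ F p' j) (m : Model) : (gridGraph F).TemporallyConnected m := by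
  intro u v
  by_cases hu : ∃ p, u = rowVertex K p <;> by_cases hv : ∃ p, v = rowVertex K p
  · obtain ⟨p, rfl⟩ := hu
    obtain ⟨p', rfl⟩ := hv
    obtain ⟨j, hj, hj'⟩ := h p p'
    exact (walk_row_row hj hj').reaches m
  · obtain ⟨p, rfl⟩ := hu
    exact ((walk_row_hub j₀ p).trans (walk_from_hub p₀ v (not_exists.1 hv))
      (by decide) (by decide) (by decide)).reaches m
  · obtain ⟨p, rfl⟩ := hv
    exact ((walk_to_hub p₀ u (not_exists.1 hu)).trans (walk_hub_row j₀ p)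
      (by decide) (by decide) (by decide)).reaches m
  · exact ((walk_to_hub p₀ u (not_exists.1 hu)).trans (walk_from_hub p₀ v (not_exists.1 hv))
      (by decide) (by decide) (by decide)).reaches m

/-- The two properties hold or fail together: they hold if and only if for any two rows `F` is true
in a common column. -/
theorem connectivity_gridGraph (p₀ : Fin Q) (j₀ : Fin K)
    (hF : ∀ p, ∃ j, F p j) (m : Model) :
    ((gridGraph F).TemporallyConnected m ↔ ∀ p p', ∃ j, F p j ∧ F p' j) ∧
    ((gridGraph F).TemporallyUnilaterallyConnected m ↔ ∀ p p', ∃ j, F p j ∧ F p' j) := by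
  have h1 : (∀ p p', ∃ j, F p j ∧ F p' j) → (gridGraph F).TemporallyConnected m :=
    fun h => temporallyConnected_gridGraph p₀ j₀ h m
  have h2 : (gridGraph F).TemporallyConnected m →
      (gridGraph F).TemporallyUnilaterallyConnected m := fun h u v => .inl (h u v)
  have h3 : (gridGraph F).TemporallyUnilaterallyConnected m → ∀ p p', ∃ j, F p j ∧ F p' j := by
    intro h p p'
    by_contra hc
    have hne : p ≠ p' := by
      rintro rfl
      obtain ⟨j, hj⟩ := hF p
      exact hc ⟨j, hj, hj⟩
    rcases h (rowVertex K p) (rowVertex K p') with hr | hr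
    · exact not_reaches_row hne (fun j hj => hc ⟨j, hj⟩) m hr
    · exact not_reaches_row hne.symm (fun j hj => hc ⟨j, hj.symm⟩) m hr
  exact ⟨⟨fun h => h3 (h2 h), h1⟩, ⟨h3, fun h => h2 (h1 h)⟩⟩

end Grid

/-! ### The graph of a formula -/

/-- The clauses of a formula, with the literals replaced by their codes. -/
def CNF.codes (φ : CNF) : List (List ℕ) :=
  φ.clauses.map fun c => c.map fun l => 2 * (l.1 : ℕ) + l.2.toNat

theorem CNF.encode_eq (φ : CNF) :
    φ.encode = φ.numVars :: φ.codes.length :: φ.codes.flatMap encodeClause := by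
  simp [CNF.encode, CNF.codes, CNF.numClauses, encodeClause, List.flatMap_map]

/-- The columns of the graph are the clauses and the two additional columns. The value is true if
the partial assignment makes no literal of the clause true, or has the parity that belongs to the
additional column. -/
def falsifies (Q : ℕ) (cs : List (List ℕ)) (p : Fin Q) (j : Fin (cs.length + 2)) : Bool :=
  (rowTimes p cs).getD j 0 = 7

theorem length_rowTimes (p : ℕ) (cs : List (List ℕ)) :
    (rowTimes p cs).length = cs.length + 2 := by simp [rowTimes]

theorem mem_rowTimes {p x : ℕ} {cs : List (List ℕ)} (h : x ∈ rowTimes p cs) : x = 7 ∨ x = 2 := by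
  simp only [rowTimes, List.mem_append, List.mem_map, List.mem_cons, List.not_mem_nil,
    or_false] at h
  rcases h with ⟨c, -, rfl⟩ | rfl | rfl
  · unfold cellTime; split_ifs <;> simp
  · omega
  · omega

theorem ite_falsifies {Q : ℕ} {cs : List (List ℕ)} (p : Fin Q) (j : Fin (cs.length + 2)) :
    (if falsifies Q cs p j then 7 else 2) = (rowTimes p cs).getD j 0 := by
  have hj : (j : ℕ) < (rowTimes p cs).length := by rw [length_rowTimes]; exact j.2
  have hm : (rowTimes p cs).getD j 0 ∈ rowTimes p cs := by
    rw [List.getD_eq_getElem _ _ hj]; exact List.getElem_mem hj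
  rcases mem_rowTimes hm with h | h
  · rw [falsifies, h]; rfl
  · rw [falsifies, h]; rfl

theorem rowOut_eq_flatMap (pv hub : ℕ) (xs : List ℕ) : ∀ leaf c, rowOut pv hub leaf c xs =
    (List.range xs.length).flatMap fun j => cell (leaf + j) pv (c + j) hub (xs.getD j 0) := by
  induction xs with
  | nil => intro leaf c; rfl
  | cons x xs ih =>
    intro leaf c
    rw [rowOut, ih, List.length_cons, List.range_succ_eq_map, List.flatMap_cons, List.flatMap_map]
    simp only [List.getD_cons_succ, List.getD_cons_zero, add_zero, Nat.succ_eq_add_one, add_assoc,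
      add_comm 1]

theorem flatMap_range_eq {α : Type*} (n : ℕ) (f : ℕ → List α) :
    (List.range n).flatMap f = (List.finRange n).flatMap fun i : Fin n => f i := by
  rw [← List.map_coe_finRange_eq_range, List.flatMap_map]

theorem length_gridListing {Q K : ℕ} (F : Fin Q → Fin K → Bool) :
    (gridListing F).length = Q * K * 20 := by
  have : ∀ pj, (leafEdges F pj).length = 20 := fun _ => rfl
  simp [gridListing, List.length_flatMap, this, List.length_product]

/-- The program writes down a listing of the graph. -/
theorem graphOut_eq_encode (n : ℕ) (cs : List (List ℕ)) :
    graphOut n cs = (gridGraph (falsifies (numPartial n) cs)).encode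
      (gridListing (falsifies (numPartial n) cs)) := by
  rw [graphOut, TemporalGraph.encode, length_gridListing]
  set Q := numPartial n
  have hN : Q * (cs.length + 2 + 1) + (cs.length + 2) + 1 = (Q + 1) * (cs.length + 2 + 1) := by ring
  simp only [hN]
  refine congrArg (_ :: 12 :: _ :: ·) ?_
  rw [flatMap_range_eq, gridListing]
  change _ = ((List.flatMap (fun p => List.map (Prod.mk p) _) _).flatMap _).flatMap _
  simp only [List.flatMap_assoc, List.flatMap_map]
  refine List.flatMap_congr fun p _ => ?_
  rw [row, rowOut_eq_flatMap, length_rowTimes, flatMap_range_eq]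
  refine List.flatMap_congr fun j _ => ?_
  rw [← ite_falsifies]
  have e1 : ((leafVertex p j : Fin _) : ℕ) = p * (cs.length + 2 + 1) + j := by
    simp [leafVertex, gridVertex]; ring
  have e2 : ((rowVertex (cs.length + 2) p : Fin _) : ℕ) =
      p * (cs.length + 2 + 1) + (cs.length + 2) := by
    simp [rowVertex, gridVertex]; ring
  have e3 : ((colVertex Q j : Fin _) : ℕ) =
      Q * (cs.length + 2 + 1) + (cs.length + 2) - (cs.length + 2) + j := by
    rw [Nat.add_sub_cancel]; simp [colVertex, gridVertex]; ring
  have e4 : ((hubVertex Q (cs.length + 2) : Fin _) : ℕ) =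
      Q * (cs.length + 2 + 1) + (cs.length + 2) := by
    simp [hubVertex, gridVertex]; ring
  simp only [leafEdges, leafIncidences, cell, incidences, List.flatMap_cons,
    List.flatMap_nil, List.append_nil, List.cons_append, List.nil_append, e1, e2, e3, e4]

theorem exists_falsifies_iff {Q : ℕ} {cs : List (List ℕ)} (p p' : Fin Q) :
    (∃ j, falsifies Q cs p j ∧ falsifies Q cs p' j) ↔
      (p : ℕ) % 2 = p' % 2 ∨
        ∃ c ∈ cs, c.any (litTrue p) = false ∧ c.any (litTrue p') = false := by
  have key : ∀ (c : List ℕ) (q : ℕ), cellTime q c = 7 ↔ c.any (litTrue q) = false := by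
    intro c q; unfold cellTime; cases c.any (litTrue q) <;> simp
  have hdef : ∀ (q : Fin Q) j, falsifies Q cs q j ↔ (rowTimes q cs).getD j 0 = 7 :=
    fun q j => decide_eq_true_iff
  simp only [hdef, rowTimes]
  constructor
  · rintro ⟨⟨j, hj⟩, h1, h2⟩
    simp only at h1 h2
    rcases lt_or_ge j cs.length with hlt | hge
    · rw [List.getD_append _ _ _ _ (by simpa), List.getD_eq_getElem _ _ (by simpa),
        List.getElem_map, key] at h1 h2
      exact .inr ⟨_, List.getElem_mem hlt, h1, h2⟩
    · rw [List.getD_append_right _ _ _ _ (by simpa), List.length_map] at h1 h2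
      obtain h | h : j - cs.length = 0 ∨ j - cs.length = 1 := by omega
      all_goals
        rw [h] at h1 h2
        simp only [List.getD_cons_zero, List.getD_cons_succ] at h1 h2
        omega
  · rintro (h | ⟨c, hc, h1, h2⟩)
    · rcases Nat.mod_two_eq_zero_or_one p with h0 | h0
      · refine ⟨⟨cs.length, by omega⟩, ?_⟩
        rw [List.getD_append_right _ _ _ _ (by simp), List.getD_append_right _ _ _ _ (by simp)]
        simp [← h, h0]
      · refine ⟨⟨cs.length + 1, by omega⟩, ?_⟩
        rw [List.getD_append_right _ _ _ _ (by simp), List.getD_append_right _ _ _ _ (by simp)]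
        simp [← h, h0]
    · obtain ⟨j, hj, rfl⟩ := List.getElem_of_mem hc
      refine ⟨⟨j, by omega⟩, ?_⟩
      rw [List.getD_append _ _ _ _ (by simpa), List.getD_eq_getElem _ _ (by simpa),
        List.getD_append _ _ _ _ (by simpa), List.getD_eq_getElem _ _ (by simpa),
        List.getElem_map, List.getElem_map, key, key]
      exact ⟨h1, h2⟩

theorem litTrue_code (p v : ℕ) (b : Bool) :
    litTrue p (2 * v + b.toNat) ↔ v % 2 = p % 2 ∧ p.testBit (v / 2 + 1) = b := by
  have hb : b.toNat < 2 := Bool.toNat_lt b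
  have e1 : (2 * v + b.toNat) / 4 = v / 2 := by omega
  have e2 : (2 * v + b.toNat) % 4 = 2 * (v % 2) + b.toNat := by omega
  rw [litTrue, decide_eq_true_eq, e1, e2, Nat.testBit_eq_decide_div_mod_eq]
  have h2 := Nat.mod_two_eq_zero_or_one (p / 2 ^ (v / 2 + 1))
  cases b <;> rcases h2 with h2 | h2 <;> simp [h2] <;> omega

/-- The partial assignment to the variables of one parity that agrees with `f`. -/
theorem exists_partial (n : ℕ) (f : ℕ → Bool) (s : Bool) :
    ∃ p : Fin (numPartial n), (p : ℕ) % 2 = s.toNat ∧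
      ∀ v < n, v % 2 = s.toNat → (p : ℕ).testBit (v / 2 + 1) = f v := by
  let g : Fin ((n + 1) / 2 + 1) → Bool := fun i =>
    if (i : ℕ) = 0 then s else f (2 * (i - 1) + s.toNat)
  have hlt : Nat.ofBits g < numPartial n := by
    rw [numPartial, ← pow_succ']; exact Nat.ofBits_lt_two_pow g
  refine ⟨⟨Nat.ofBits g, hlt⟩, ?_, fun v hv hs => ?_⟩
  · have := Nat.testBit_ofBits_lt g 0 (Nat.succ_pos _)
    rw [Nat.testBit_zero, show g ⟨0, _⟩ = s from if_pos rfl] at this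
    rw [← this]
    rcases Nat.mod_two_eq_zero_or_one (Nat.ofBits g) with h | h <;> simp [h]
  · have := Nat.testBit_ofBits_lt g (v / 2 + 1) (by omega)
    rw [this]
    simp only [g, Nat.add_sub_cancel, Nat.succ_ne_zero, if_false]
    congr 1
    omega

/-- Two partial assignments that falsify no clause together form a satisfying assignment. -/
theorem satisfiable_iff (φ : CNF) :
    (∀ p p', ∃ j, falsifies (numPartial φ.numVars) φ.codes p j ∧
      falsifies (numPartial φ.numVars) φ.codes p' j) ↔ ¬ φ.Satisfiable := by
  simp only [exists_falsifies_iff]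
  constructor
  · rintro h ⟨f, hf⟩
    let f' : ℕ → Bool := fun v => if hv : v < φ.numVars then f ⟨v, hv⟩ else false
    obtain ⟨p, hp, hp'⟩ := exists_partial φ.numVars f' false
    obtain ⟨q, hq, hq'⟩ := exists_partial φ.numVars f' true
    rcases h p q with h | ⟨c, hc, h1, h2⟩
    · rw [hp, hq] at h; cases h
    · obtain ⟨c, hcφ, rfl⟩ := List.mem_map.1 hc
      obtain ⟨⟨v, b⟩, hl, hfl⟩ := hf c hcφ
      rw [List.any_eq_false] at h1 h2
      have h1 := h1 _ (List.mem_map_of_mem hl)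
      have h2 := h2 _ (List.mem_map_of_mem hl)
      rw [litTrue_code] at h1 h2
      have hfv : f' v = b := by simpa [f'] using hfl
      rcases Nat.mod_two_eq_zero_or_one v with hv | hv
      · exact h1 ⟨hv.trans hp.symm, (hp' v v.2 hv).trans hfv⟩
      · exact h2 ⟨hv.trans hq.symm, (hq' v v.2 hv).trans hfv⟩
  · intro h p q
    by_contra hc
    rw [not_or] at hc
    refine h ⟨fun v => if (v : ℕ) % 2 = p % 2 then (p : ℕ).testBit (v / 2 + 1)
      else (q : ℕ).testBit (v / 2 + 1), fun c hcφ => ?_⟩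
    by_contra hno
    refine hc.2 ⟨_, List.mem_map_of_mem hcφ, ?_, ?_⟩
    all_goals
      rw [List.any_eq_false]
      intro l hlc
      obtain ⟨⟨v, b⟩, hl, rfl⟩ := List.mem_map.1 hlc
      rw [litTrue_code]
      rintro ⟨h1, h2⟩
      dsimp only at h1 h2
      refine hno ⟨_, hl, ?_⟩
    · simp only [h1, if_true]; exact h2
    · have : (v : ℕ) % 2 ≠ p % 2 := by
        have := hc.1; omega
      simp only [this, if_false]; exact h2

/-! ### Combining the reduction with a decision procedure -/

/-- A computation of cost `t` lengthens the numbers by at most `t` digits. This bounds the cost of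
testing the answer of a decision procedure, which can be any nonzero number. -/
theorem Exec.size_le {p : Prog} {s s' : State} {t : ℕ} (h : Exec p s s' t) :
    ∀ b, (∀ r, Nat.size (s.reg r) ≤ b) → (∀ a, Nat.size (s.mem a) ≤ b) →
      (∀ r, Nat.size (s'.reg r) ≤ b + t) ∧ ∀ a, Nat.size (s'.mem a) ≤ b + t := by
  induction h with
  | skip s => exact fun b h1 h2 => ⟨fun r => (h1 r).trans (by omega), fun r => (h2 r).trans (by omega)⟩
  | const d c s =>
    refine fun b h1 h2 => ⟨fun r => ?_, fun r => (h2 r).trans (by omega)⟩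
    simp only [State.setReg, Function.update_apply]
    split_ifs
    · omega
    · exact (h1 r).trans (by omega)
  | arith o d x y s =>
    refine fun b h1 h2 => ⟨fun r => ?_, fun r => (h2 r).trans (by omega)⟩
    simp only [State.setReg, Function.update_apply]
    split_ifs
    · have hx := Nat.lt_size_self (s.reg x)
      have hy := Nat.lt_size_self (s.reg y)
      have h1x := h1 x
      refine le_trans ?_ (Nat.le_add_left _ b)
      cases o with
      | add =>
        rw [Nat.size_le, ArithOp.eval]
        have := Nat.pow_le_pow_right (n := 2) (by decide)
          (Nat.le_add_right (Nat.size (s.reg x)) (Nat.size (s.reg y)))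
        have := Nat.pow_le_pow_right (n := 2) (by decide)
          (Nat.le_add_left (Nat.size (s.reg y)) (Nat.size (s.reg x)))
        rw [add_assoc, pow_add]
        omega
      | sub => exact (Nat.size_le_size (Nat.sub_le _ _)).trans (by omega)
      | mul =>
        refine le_trans ((Nat.size_le (n := Nat.size (s.reg x) + Nat.size (s.reg y))).2 ?_) (by omega)
        rw [ArithOp.eval, pow_add]
        exact Nat.mul_lt_mul'' hx hy
      | div => exact (Nat.size_le_size (Nat.div_le_self _ _)).trans (by omega)
    · exact (h1 r).trans (by omega)
  | load d x s =>
    refine fun b h1 h2 => ⟨fun r => ?_, fun r => (h2 r).trans (by omega)⟩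
    simp only [State.setReg, Function.update_apply]
    split_ifs
    · exact (h2 _).trans (by omega)
    · exact (h1 r).trans (by omega)
  | store x y s =>
    refine fun b h1 h2 => ⟨fun r => (h1 r).trans (by omega), fun r => ?_⟩
    simp only [State.setMem, Function.update_apply]
    split_ifs
    · exact (h1 _).trans (by omega)
    · exact (h2 r).trans (by omega)
  | seq _ _ ih1 ih2 =>
    intro b h1 h2
    obtain ⟨h3, h4⟩ := ih1 b h1 h2
    simpa [add_assoc] using ih2 _ h3 h4
  | cond_true _ _ ih =>
    intro b h1 h2
    obtain ⟨h3, h4⟩ := ih b h1 h2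
    exact ⟨fun r => (h3 r).trans (by omega), fun r => (h4 r).trans (by omega)⟩
  | cond_false _ _ ih =>
    intro b h1 h2
    obtain ⟨h3, h4⟩ := ih b h1 h2
    exact ⟨fun r => (h3 r).trans (by omega), fun r => (h4 r).trans (by omega)⟩
  | loop_true _ _ _ ih1 ih2 =>
    intro b h1 h2
    obtain ⟨h3, h4⟩ := ih1 b h1 h2
    obtain ⟨h5, h6⟩ := ih2 _ h3 h4
    exact ⟨fun r => (h5 r).trans (by omega), fun r => (h6 r).trans (by omega)⟩
  | loop_false _ =>
    exact fun b h1 h2 => ⟨fun r => (h1 r).trans (by omega), fun r => (h2 r).trans (by omega)⟩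

/-- First the reduction, then the decision procedure, and finally the negation of its answer. -/
def satSolver (P : Prog) : Prog :=
  .seq reduction (.seq P (.cond 0 (.const 0 0) (.const 0 1)))

theorem answersWithin_satSolver {P : Prog} {x y : List ℕ} {B k : ℕ} {R S : Prop} {T : ℝ}
    (hx : (inputConfig x).Bounded B) (hred : Runs B reduction (inputConfig x) (inputConfig y) k)
    (hP : AnswersWithin P y R T) (hRS : R ↔ ¬ S) :
    AnswersWithin (satSolver P) x S (k * (2 * B + 1) + 2 * T + B + 3) := by
  obtain ⟨hy, t₁, ht₁, he₁⟩ := hred hx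
  obtain ⟨s, t₂, he₂, hR, ht₂⟩ := hP
  rw [toState_inputConfig, toState_inputConfig] at he₁
  have hsize : Nat.size (s.reg 0) ≤ B + t₂ := by
    refine (he₂.size_le B (fun r => ?_) (fun a => ?_)).1 0
    · rw [← toState_inputConfig]; exact hy.size_reg r
    · rw [← toState_inputConfig]; exact hy.size_mem a
  have ht₁' : (t₁ : ℝ) ≤ k * (2 * B + 1) := by exact_mod_cast ht₁
  have hsize' : (Nat.size (s.reg 0) : ℝ) ≤ B + t₂ := by exact_mod_cast hsize
  by_cases h0 : s.reg 0 = 0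
  · refine ⟨_, _, he₁.seq (he₂.seq (.cond_false h0 (.const 0 1 s))), ?_, ?_⟩
    · have : S := not_not.1 fun h => (hR.2 (hRS.2 h)) h0
      simp [State.setReg, this]
    · have : (0 : ℝ) ≤ B := Nat.cast_nonneg B
      have : (0 : ℝ) ≤ t₂ := Nat.cast_nonneg t₂
      push_cast [Nat.size_one]
      linarith
  · refine ⟨_, _, he₁.seq (he₂.seq (.cond_true h0 (.const 0 0 s))), ?_, ?_⟩
    · have : ¬ S := hRS.1 (hR.1 h0)
      simp [State.setReg, this]
    · push_cast [Nat.size_zero]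
      linarith

/-! ### The running time -/

theorem numPartial_le (n : ℕ) : numPartial n ≤ 2 ^ (n + 1) := by
  rw [numPartial, ← pow_succ']
  exact Nat.pow_le_pow_right (by decide) (by omega)

theorem one_le_numPartial (n : ℕ) : 1 ≤ numPartial n := by
  have := Nat.one_le_two_pow (n := (n + 1) / 2)
  unfold numPartial; omega

theorem numPartial_le_rpow (n : ℕ) : (numPartial n : ℝ) ≤ 4 * (2 : ℝ) ^ ((n : ℝ) / 2) := by
  have h1 : (2 : ℝ) ^ ((n + 1) / 2) ≤ (2 : ℝ) ^ ((n : ℝ) / 2 + 1) := by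
    rw [← Real.rpow_natCast]
    refine Real.rpow_le_rpow_of_exponent_le (by norm_num) ?_
    have : (((n + 1) / 2 : ℕ) : ℝ) ≤ ((n + 1 : ℕ) : ℝ) / 2 := Nat.cast_div_le
    push_cast at this ⊢
    linarith
  rw [Real.rpow_add_one (by norm_num)] at h1
  rw [numPartial]
  push_cast
  linarith

theorem CNF.IsKCNF.length_encode_le {φ : CNF} {k : ℕ} (h : φ.IsKCNF k) :
    φ.encode.length ≤ 2 + φ.numClauses * (k + 1) := by
  have : ∀ l : List (List (Fin φ.numVars × Bool)), (∀ c ∈ l, c.length ≤ k) →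
      (l.flatMap fun c => c.length :: c.map fun l => 2 * (l.1 : ℕ) + l.2.toNat).length ≤
        l.length * (k + 1) := by
    intro l
    induction l with
    | nil => simp
    | cons c l ih =>
      intro hl
      have h1 := hl c (by simp)
      have h2 := ih fun c hc => hl c (by simp [hc])
      simp only [List.flatMap_cons, List.length_append, List.length_cons, List.length_map,
        add_mul] at h2 ⊢
      omega
  have := this φ.clauses h
  simp only [CNF.encode, CNF.numClauses, List.length_cons] at this ⊢
  omega

theorem CNF.IsKCNF.mem_codes {φ : CNF} {k : ℕ} (h : φ.IsKCNF k) :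
    ∀ c ∈ φ.codes, c.length ≤ k ∧ ∀ l ∈ c, l ≤ 4 * φ.numVars := by
  intro c hc
  obtain ⟨c, hcφ, rfl⟩ := List.mem_map.1 hc
  refine ⟨by simpa using h c hcφ, fun l hl => ?_⟩
  obtain ⟨⟨v, b⟩, -, rfl⟩ := List.mem_map.1 hl
  have := Bool.toNat_lt b
  have := v.2
  dsimp only
  omega

theorem CNF.length_codes (φ : CNF) : φ.codes.length = φ.numClauses := by
  simp [CNF.codes, CNF.numClauses]

/-- The digits that suffice for all numbers that occur in the reduction. -/
def CNF.digits (φ : CNF) (k : ℕ) : ℕ := φ.numVars + φ.numClauses + k + 10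

theorem CNF.IsKCNF.mem_encode_lt {φ : CNF} {k : ℕ} (h : φ.IsKCNF k) :
    ∀ v ∈ φ.encode, v + 1 < 2 ^ φ.digits k := by
  have h4 : 4 * φ.digits k ≤ 2 ^ φ.digits k := by
    have h1 := (Nat.lt_two_pow_self (n := φ.digits k - 3)).le
    have h2 : 2 ^ φ.digits k = 8 * 2 ^ (φ.digits k - 3) := by
      rw [← Nat.pow_add 2 3, Nat.add_sub_cancel' (by simp only [CNF.digits]; omega)]
    simp only [CNF.digits] at *
    omega
  have h4 : 4 * (φ.numVars + φ.numClauses + k + 10) ≤ 2 ^ φ.digits k := h4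
  intro v hv
  rw [CNF.encode_eq, CNF.length_codes] at hv
  simp only [List.mem_cons, List.mem_flatMap, encodeClause] at hv
  rcases hv with rfl | rfl | ⟨c, hc, rfl | hv⟩
  · omega
  · omega
  · have := (h.mem_codes c hc).1; omega
  · have := (h.mem_codes c hc).2 v hv; omega

theorem CNF.IsKCNF.bounded {φ : CNF} {k : ℕ} (h : φ.IsKCNF k)
    (hlen : φ.encode.length < 2 ^ φ.digits k) :
    (inputConfig φ.encode).Bounded (φ.digits k) := by
  have hpos : 0 < 2 ^ φ.digits k := Nat.two_pow_pos _
  refine ⟨fun r => ?_, fun a => ?_⟩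
  · change (inputConfig φ.encode).toState.reg r < _
    rw [toState_inputConfig]
    simp only [initState]
    split_ifs
    · exact hlen
    · exact hpos
  · change φ.encode.getD a 0 < _
    rcases lt_or_ge a φ.encode.length with ha | ha
    · rw [List.getD_eq_getElem _ _ ha]
      exact (Nat.lt_succ_self _).trans (h.mem_encode_lt _ (List.getElem_mem ha))
    · rwa [List.getD_eq_default _ _ ha]

theorem CNF.IsKCNF.length_lt {φ : CNF} {k : ℕ} (h : φ.IsKCNF k) :
    (graphOut φ.numVars φ.codes).length + φ.encode.length + φ.encode.length + 20 <
      2 ^ φ.digits k := by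
  have h1 := h.length_encode_le
  rw [length_graphOut, CNF.length_codes]
  have h2 := numPartial_le φ.numVars
  set n := φ.numVars
  set m := φ.numClauses
  have hm : m + 1 ≤ 2 ^ m := Nat.lt_two_pow_self
  have hk : k + 1 ≤ 2 ^ k := Nat.lt_two_pow_self
  have hn : 1 ≤ 2 ^ n := Nat.one_le_two_pow
  have h3 : numPartial n * (m + 2) ≤ 2 ^ (n + 1) * 2 ^ (m + 1) :=
    Nat.mul_le_mul h2 (by rw [pow_succ]; omega)
  have h4 : m * (k + 1) ≤ 2 ^ m * 2 ^ k := Nat.mul_le_mul (by omega) hk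
  have h5 : 2 ^ m * 2 ^ n ≤ 2 ^ m * 2 ^ n * 2 ^ k := Nat.le_mul_of_pos_right _ (by omega)
  have h6 : 2 ^ m * 2 ^ k ≤ 2 ^ m * 2 ^ k * 2 ^ n := Nat.le_mul_of_pos_right _ (by omega)
  have h7 : 1 ≤ 2 ^ m * 2 ^ n := Nat.mul_pos (by omega) (by omega)
  have e1 : 2 ^ (n + 1) * 2 ^ (m + 1) = 4 * (2 ^ m * 2 ^ n) := by ring
  have e2 : 2 ^ φ.digits k = 1024 * (2 ^ m * 2 ^ n * 2 ^ k) := by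
    change 2 ^ (n + m + k + 10) = _
    ring
  have e3 : 2 ^ m * 2 ^ k * 2 ^ n = 2 ^ m * 2 ^ n * 2 ^ k := by ring
  omega

/-- Exponential factor of the running time of the reduction and of the decision procedure. -/
theorem two_pow_half_le {n : ℕ} {δ : ℝ} (hδ : δ ≤ 1) :
    (2 : ℝ) ^ ((n : ℝ) / 2) ≤ (2 : ℝ) ^ ((1 - δ / 2) * (n : ℝ)) := by
  refine Real.rpow_le_rpow_of_exponent_le (by norm_num) ?_
  have : (0 : ℝ) ≤ n := Nat.cast_nonneg n
  nlinarith

/-- The cost of the reduction is `2 ^ (n / 2)` up to polynomial factors. The summands after the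
product account for the negation of the answer. -/
theorem reduction_time_le {n m k len : ℕ} (hlen : len ≤ 2 + m * (k + 1)) :
    ((3 * n + 15 * len + numPartial n * (m * (k * (3 * n + 31) + 140) + 301) + 110 : ℕ) : ℝ) *
      (2 * ((n + m + k + 10 : ℕ) : ℝ) + 1) + ((n + m + k + 10 : ℕ) : ℝ) + 3 ≤
      100000 * ((k : ℝ) + 1) ^ 2 * (2 : ℝ) ^ ((n : ℝ) / 2) * ((n : ℝ) + m + 1) ^ 3 := by
  have hQ := numPartial_le_rpow n
  have hQ1 := one_le_numPartial n
  set Q := numPartial n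
  -- everything is a polynomial in `κ = k + 1` and `N = n + m + 1`, up to the factor `Q`
  have h1 : 3 * n + 15 * len + Q * (m * (k * (3 * n + 31) + 140) + 301) + 110 ≤
      Q * (700 * ((k + 1) * (n + m + 1) ^ 2)) := by
    have hX : 3 * n + 15 * len + 110 + (m * (k * (3 * n + 31) + 140) + 301) ≤
        700 * ((k + 1) * (n + m + 1) ^ 2) := by
      linarith [Nat.zero_le (k * m), Nat.zero_le (k * n), Nat.zero_le (k * m * n),
        Nat.zero_le (k * m * m), Nat.zero_le (k * n * n), Nat.zero_le (m * n),
        Nat.zero_le (m * m), Nat.zero_le (n * n)]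
    have := Nat.mul_le_mul_left Q hX
    rw [mul_add] at this
    have := Nat.le_mul_of_pos_left (3 * n + 15 * len + 110) hQ1
    omega
  have h2 : 2 * (n + m + k + 10) + 1 ≤ 21 * ((k + 1) * (n + m + 1)) := by nlinarith
  have h3 : n + m + k + 10 + 3 ≤ Q * (20 * ((k + 1) ^ 2 * (n + m + 1) ^ 3)) := by
    have : n + m + k + 10 + 3 ≤ 20 * ((k + 1) ^ 2 * (n + m + 1) ^ 3) := by
      have ha : k + 1 ≤ (k + 1) ^ 2 := Nat.le_self_pow (by decide) _
      have hb : n + m + 1 ≤ (n + m + 1) ^ 3 := Nat.le_self_pow (by decide) _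
      have hab : (k + 1) * (n + m + 1) ≤ (k + 1) ^ 2 * (n + m + 1) ^ 3 := Nat.mul_le_mul ha hb
      nlinarith
    exact this.trans (Nat.le_mul_of_pos_left _ hQ1)
  have h4 : (3 * n + 15 * len + Q * (m * (k * (3 * n + 31) + 140) + 301) + 110) *
      (2 * (n + m + k + 10) + 1) + (n + m + k + 10) + 3 ≤
      14720 * ((k + 1) ^ 2 * (n + m + 1) ^ 3) * Q := by
    have e : Q * (700 * ((k + 1) * (n + m + 1) ^ 2)) * (21 * ((k + 1) * (n + m + 1))) +
      Q * (20 * ((k + 1) ^ 2 * (n + m + 1) ^ 3)) =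
      14720 * ((k + 1) ^ 2 * (n + m + 1) ^ 3) * Q := by ring
    rw [← e, add_assoc _ (n + m + k + 10) 3]
    exact Nat.add_le_add (Nat.mul_le_mul h1 h2) h3
  have h5 : (((3 * n + 15 * len + Q * (m * (k * (3 * n + 31) + 140) + 301) + 110) *
      (2 * (n + m + k + 10) + 1) + (n + m + k + 10) + 3 : ℕ) : ℝ) ≤
      14720 * (((k : ℝ) + 1) ^ 2 * ((n : ℝ) + m + 1) ^ 3) * Q := by exact_mod_cast h4
  have h6 : 14720 * (((k : ℝ) + 1) ^ 2 * ((n : ℝ) + m + 1) ^ 3) * Q ≤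
      14720 * (((k : ℝ) + 1) ^ 2 * ((n : ℝ) + m + 1) ^ 3) * (4 * (2 : ℝ) ^ ((n : ℝ) / 2)) :=
    mul_le_mul_of_nonneg_left hQ (by positivity)
  have h7 : (0 : ℝ) ≤ ((k : ℝ) + 1) ^ 2 * ((n : ℝ) + m + 1) ^ 3 * (2 : ℝ) ^ ((n : ℝ) / 2) := by
    positivity
  push_cast at h5 ⊢
  linarith

/-- The time bound for a graph with at most `20 Q (m + 2)` temporal edges, where `Q` is the number
of partial assignments. -/
theorem decision_time_le {n m M c : ℕ} {C ε δ : ℝ} (hM : M ≤ numPartial n * (m + 2) * 20)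
    (hδ0 : 0 < δ) (hδ1 : δ ≤ 1) (hδε : δ ≤ ε) :
    C * (M : ℝ) ^ (2 - ε) * Real.log (2 + M + (12 : ℕ)) ^ c ≤
      |C| * 25600 * 10 ^ c * (2 : ℝ) ^ ((1 - δ / 2) * (n : ℝ)) * ((n : ℝ) + m + 1) ^ (c + 2) := by
  have hQ := numPartial_le_rpow n
  have hQ1 := one_le_numPartial n
  have hQ2 := numPartial_le n
  set N : ℝ := (n : ℝ) + m + 1 with hN
  have hn0 : (0 : ℝ) ≤ n := Nat.cast_nonneg n
  have hm0 : (0 : ℝ) ≤ m := Nat.cast_nonneg m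
  have hN1 : 1 ≤ N := by linarith
  have hE : (0 : ℝ) < (2 : ℝ) ^ ((n : ℝ) / 2) := by positivity
  set L : ℝ := 160 * N * (2 : ℝ) ^ ((n : ℝ) / 2) with hL
  have hE1 : (1 : ℝ) ≤ (2 : ℝ) ^ ((n : ℝ) / 2) := Real.one_le_rpow (by norm_num) (by positivity)
  have hL1 : 1 ≤ L := by
    have : (1 : ℝ) * 1 ≤ (160 * N) * (2 : ℝ) ^ ((n : ℝ) / 2) :=
      mul_le_mul (by linarith) hE1 zero_le_one (by linarith)
    linarith
  have hML : (M : ℝ) ≤ L := by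
    have h1 : (M : ℝ) ≤ numPartial n * (m + 2) * 20 := by exact_mod_cast hM
    have h2 : (numPartial n : ℝ) * (m + 2) ≤ (4 * (2 : ℝ) ^ ((n : ℝ) / 2)) * (2 * N) :=
      mul_le_mul hQ (by linarith) (by positivity) (by positivity)
    linarith
  have hpow : (M : ℝ) ^ (2 - ε) ≤ 25600 * N ^ 2 * (2 : ℝ) ^ ((1 - δ / 2) * (n : ℝ)) := by
    have h1 : (M : ℝ) ^ (2 - ε) ≤ L ^ (2 - δ) := by
      rcases le_or_gt 0 (2 - ε) with h | h
      · exact (Real.rpow_le_rpow (Nat.cast_nonneg M) hML h).trans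
          (Real.rpow_le_rpow_of_exponent_le hL1 (by linarith))
      · -- a negative exponent makes the power at most one, also for `M = 0`
        refine le_trans ?_ (Real.one_le_rpow hL1 (by linarith))
        rcases Nat.eq_zero_or_pos M with rfl | hpos
        · rw [Nat.cast_zero, Real.zero_rpow h.ne]; exact zero_le_one
        · exact Real.rpow_le_one_of_one_le_of_nonpos (by exact_mod_cast hpos) h.le
    refine h1.trans ?_
    rw [hL, Real.mul_rpow (by positivity) hE.le, ← Real.rpow_mul (by norm_num)]
    have h2 : (160 * N) ^ (2 - δ) ≤ (160 * N) ^ (2 : ℝ) :=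
      Real.rpow_le_rpow_of_exponent_le (by linarith) (by linarith)
    rw [Real.rpow_two] at h2
    have h3 : (n : ℝ) / 2 * (2 - δ) = (1 - δ / 2) * n := by ring
    rw [h3]
    exact (mul_le_mul_of_nonneg_right h2 (by positivity)).trans (by rw [mul_pow]; norm_num)
  have hlog0 : 0 ≤ Real.log (2 + M + (12 : ℕ)) := by
    refine Real.log_nonneg ?_
    have : (0 : ℝ) ≤ M := Nat.cast_nonneg M
    push_cast; linarith
  have hlog : Real.log (2 + M + (12 : ℕ)) ≤ 10 * N := by
    have h1 : 2 + M + 12 ≤ 2 ^ (n + m + 10) := by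
      have h2 : m + 1 ≤ 2 ^ m := Nat.lt_two_pow_self
      have h3 : numPartial n * (m + 2) ≤ 2 ^ (n + 1) * 2 ^ (m + 1) :=
        Nat.mul_le_mul hQ2 (by rw [pow_succ]; omega)
      have e1 : 2 ^ (n + 1) * 2 ^ (m + 1) = 4 * 2 ^ (n + m) := by ring
      have e2 : 2 ^ (n + m + 10) = 1024 * 2 ^ (n + m) := by ring
      have := Nat.one_le_two_pow (n := n + m)
      omega
    have h2 : (2 + M + (12 : ℕ) : ℝ) ≤ 2 ^ (n + m + 10) := by exact_mod_cast h1
    have h3 := Real.log_le_log (by positivity) h2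
    rw [Real.log_pow] at h3
    have h4 : Real.log 2 ≤ 1 := by
      have := Real.log_two_lt_d9; linarith
    have h5 : ((n + m + 10 : ℕ) : ℝ) * Real.log 2 ≤ ((n + m + 10 : ℕ) : ℝ) * 1 :=
      mul_le_mul_of_nonneg_left h4 (Nat.cast_nonneg _)
    push_cast at h5 h3 ⊢
    linarith
  calc C * (M : ℝ) ^ (2 - ε) * Real.log (2 + M + (12 : ℕ)) ^ c
      ≤ |C| * (M : ℝ) ^ (2 - ε) * Real.log (2 + M + (12 : ℕ)) ^ c := by
        gcongr; exact le_abs_self C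
    _ ≤ |C| * (25600 * N ^ 2 * (2 : ℝ) ^ ((1 - δ / 2) * (n : ℝ))) * (10 * N) ^ c := by
        gcongr
    _ = |C| * 25600 * 10 ^ c * (2 : ℝ) ^ ((1 - δ / 2) * (n : ℝ)) * N ^ (c + 2) := by
        rw [mul_pow, pow_add]; ring

/-- A property that distinguishes the graphs of satisfiable and unsatisfiable formulas has no
decision procedure in subquadratic time. -/
theorem not_decidableInSoftTime (hSETH : SETH) (κ : Kind) {ε : ℝ} (hε : 0 < ε)
    {R : ∀ n : ℕ, TemporalGraph n → Prop}
    (hR : ∀ φ : CNF, R _ (gridGraph (falsifies (numPartial φ.numVars) φ.codes)) ↔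
      ¬ φ.Satisfiable) :
    ¬ DecidableInSoftTime κ R (2 - ε) := by
  rintro ⟨P, C, c, hP⟩
  set δ : ℝ := min ε 1 with hδ
  have hδ0 : 0 < δ := lt_min hε one_pos
  have hδ1 : δ ≤ 1 := min_le_right _ _
  obtain ⟨k, hk⟩ := hSETH (δ / 2) (by positivity)
  refine hk ⟨satSolver P, 100000 * ((k : ℝ) + 1) ^ 2 + 2 * (|C| * 25600 * 10 ^ c), c + 3,
    fun φ hφ => ?_⟩
  set n := φ.numVars with hn
  set m := φ.numClauses with hm
  have hlt := hφ.length_lt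
  have hlen := hφ.length_encode_le
  have hrun := runs_reduction (B := φ.digits k) (k := k) φ.encode_eq
    (by simp only [CNF.digits]; omega) hlt hφ.mem_encode_lt hφ.mem_codes
  have hp : 0 < numPartial n := one_le_numPartial n
  have hdec := hP _ (gridGraph (falsifies (numPartial n) φ.codes)) (gridListing _)
    (by positivity) (isOfKind_gridGraph κ) (noIsolated_gridGraph ⟨0, hp⟩ ⟨0, by omega⟩)
    isListing_gridListing
  rw [← graphOut_eq_encode] at hdec
  have hM := numTemporalEdges_le_length (isListing_gridListing
    (F := falsifies (numPartial n) φ.codes)) κ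
  have hM := hM.trans_eq (length_gridListing _)
  generalize (gridGraph (falsifies (numPartial n) φ.codes)).numTemporalEdges κ = M at hM hdec
  rw [CNF.length_codes] at hM
  obtain ⟨s, t, hex, hans, ht⟩ :=
    answersWithin_satSolver (hφ.bounded (by omega)) hrun hdec (hR φ)
  refine ⟨s, t, hex, hans, ht.trans ?_⟩
  have h1 := reduction_time_le (n := n) (m := m) (k := k) hlen
  have h2 := decision_time_le (C := C) (c := c) hM hδ0 hδ1 (min_le_left ε 1)
  have h3 := two_pow_half_le (n := n) hδ1
  change _ + 2 * (C * (M : ℝ) ^ (2 - ε) * Real.log (2 + M + (12 : ℕ)) ^ c) + _ + 3 ≤ _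
  rw [CNF.length_codes]
  set E := (2 : ℝ) ^ ((1 - δ / 2) * (n : ℝ))
  set N : ℝ := (n : ℝ) + m + 1
  have hN1 : 1 ≤ N := by
    have : (0 : ℝ) ≤ n := Nat.cast_nonneg n
    have : (0 : ℝ) ≤ m := Nat.cast_nonneg m
    linarith
  have hE : 0 < E := by positivity
  have h4 : 100000 * ((k : ℝ) + 1) ^ 2 * (2 : ℝ) ^ ((n : ℝ) / 2) * N ^ 3 ≤
      100000 * ((k : ℝ) + 1) ^ 2 * E * N ^ (c + 3) := by
    gcongr
    omega
  have h5 : |C| * 25600 * 10 ^ c * E * N ^ (c + 2) ≤ |C| * 25600 * 10 ^ c * E * N ^ (c + 3) := by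
    gcongr
    omega
  simp only [CNF.digits]
  linarith

end TemporalLowerBound

theorem theorem6 (hSETH : TemporalLowerBound.SETH) (K : TemporalLowerBound.Kind)
    (m : TemporalLowerBound.Model) (ε : ℝ) (hε : 0 < ε) :
    ¬ TemporalLowerBound.DecidableInSoftTime K
        (fun _ G => G.TemporallyConnected m) (2 - ε) ∧
    ¬ TemporalLowerBound.DecidableInSoftTime K
        (fun _ G => G.TemporallyUnilaterallyConnected m) (2 - ε) := by
  have key (φ : TemporalLowerBound.CNF) :=
    TemporalLowerBound.connectivity_gridGraph
      (F := TemporalLowerBound.falsifies (TemporalLowerBound.numPartial φ.numVars) φ.codes)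
      ⟨0, TemporalLowerBound.one_le_numPartial _⟩ ⟨0, Nat.succ_pos _⟩
      (fun p => let ⟨j, hj, _⟩ := (TemporalLowerBound.exists_falsifies_iff p p).2 (.inl rfl)
        ⟨j, hj⟩) m
  exact ⟨TemporalLowerBound.not_decidableInSoftTime hSETH K hε fun φ =>
      (key φ).1.trans (TemporalLowerBound.satisfiable_iff φ),
    TemporalLowerBound.not_decidableInSoftTime hSETH K hε fun φ =>
      (key φ).2.trans (TemporalLowerBound.satisfiable_iff φ)⟩
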